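/- Let $f:\mathbb{R}^n\to\mathbb{R}$ and $h:\mathbb{R}^n\to\mathbb{R}^m$ be smooth ($C^\infty$). Write $\nabla^\top g(x)$ for the Jacobian matrix of a map $g$ at $x$ and $\nabla g(x)$ for its transpose; norms are Euclidean. Assume: (i) $\operatorname{rank}\nabla^\top h(x)=m$ for all $x\in\mathbb{R}^n$; (ii) the feasible set $\Omega=\{x: h(x)=0\}$ is connected and there is $\rho_\eta>0$ with $f(y)\ge f(x)+\nabla^\top f(x)(y-x)+\frac{\rho_\eta}{2}\|y-x\|^2$ for all $x,y\in\Omega$; (iii) $q:\mathbb{R}^n\to\mathbb{R}^{n-m}$ is a smooth map with $\nabla^\top q(x)\nabla h(x)=0$ and $\nabla^\top q(x)\nabla q(x)=I$ for all $x$, such that $\Phi(x)=(h(x),q(x))$ is a diffeomorphism of $\mathbb{R}^n$ onto $\mathbb{R}^m\times\mathbb{R}^{n-m}$, and both $\Phi$ and $\Phi^{-1}$ are globally Lipschitz; (iv) there is $L_1>0$ such that for all $y\in\mathbb{R}^m$, $\eta\in\mathbb{R}^{n-m}$, with $\tilde x=\Phi^{-1}(y,\eta)$ and $p=\Phi^{-1}(0,\eta)$,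 $\|\nabla^\top q(\tilde x)\nabla f(\tilde x)-\nabla^\top q(p)\nabla f(p)\|\le L_1\|y\|$; (v) the map $\varphi(x)=-(\nabla^\top h(x)\nabla h(x))^{-1}\nabla^\top h(x)\nabla f(x)$ is globally Lipschitz. Then the problem $\min f(x)$ subject to $h(x)=0$ has a unique global solution $x^\star$, and there is a unique $\lambda^\star\in\mathbb{R}^m$ with $\nabla f(x^\star)+\nabla h(x^\star)\lambda^\star=0$. There is $\underline m>0$ with $\nabla^\top h(x)\nabla h(x)\succeq\underline m I$ for all $x$, and for every such $\underline m$ there is a constant $k_p^\star$ such that the following hold. (a) For all $k_p>k_p^\star$ and $0<k_i<\underline m k_p^2$, the point $(x^\star,\lambda^\star)$ is, in the coordinates $(x,\lambda)$ with $\lambda=k_ph(x)+k_iz$, a globally exponentially stable equilibrium of the PI dynamics $$\dot x=-\nabla f(x)-\nabla h(x)\bigl(k_ph(x)+k_iz\bigr),\qquad \dot z=h(x).$$ That is, it is an equilibrium, every initial state admits a solution on $[0,\infty)$, and there are $c_\pi,\rho_\pi>0$ (which may depend on $k_p,k_i$) such that every solution on $[0,\infty)$ satisfies, for all $t\ge0$,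 $$\left\|\begin{bmatrix}x(t)-x^\star\\ \lambda(t)-\lambda^\star\end{bmatrix}\right\|\le c_\pi e^{-\rho_\pi t}\left\|\begin{bmatrix}x(0)-x^\star\\ \lambda(0)-\lambda^\star\end{bmatrix}\right\|.$$ (b) For every $w\ge k_p^\star$, the point $(x^\star,\lambda^\star)$ is, in the same sense and in the coordinates $(x,\lambda)$, a globally exponentially stable equilibrium of the continuous-time augmented Lagrangian flow $\dot x=-\nabla_x\mathcal L_w(x,\lambda)$, $\dot\lambda=\nabla_\lambda\mathcal L_w(x,\lambda)$, where $\mathcal L_w(x,\lambda)=f(x)+\lambda^\top h(x)+\frac w2\|h(x)\|^2$. -/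

import Mathlib

open Set
open scoped ContDiff InnerProductSpace NNReal

noncomputable section

/-- Euclidean space `ℝᵏ` with the Euclidean norm. -/
abbrev Euc (k : ℕ) : Type := EuclideanSpace ℝ (Fin k)

/-- Pairs (stacked vectors) `[a; b] ∈ ℝᵃ × ℝᵇ` with the Euclidean norm. -/
abbrev EucPair (a b : ℕ) : Type := WithLp 2 (Euc a × Euc b)

/-- The Jacobian matrix `∇ₓᵀ g(x)`, as a linear map `ℝᵃ → ℝᵇ`. -/
def jac {a b : ℕ} (g : Euc a → Euc b) (x : Euc a) : Euc a →L[ℝ] Euc b :=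
  fderiv ℝ g x

/-- The transposed Jacobian `∇ₓ g(x)`, as a linear map `ℝᵇ → ℝᵃ`. -/
def jacT {a b : ℕ} (g : Euc a → Euc b) (x : Euc a) : Euc b →L[ℝ] Euc a :=
  ContinuousLinearMap.adjoint (jac g x)

/-- The Jacobian of the constraints has full row rank everywhere. -/
def FullRowRank {n m : ℕ} (h : Euc n → Euc m) : Prop :=
  ∀ x, Module.finrank ℝ (LinearMap.range (jac h x).toLinearMap) = m

/-- `∇ₓᵀh(x) ∇ₓh(x) ⪰ mlow · I` for all `x`. -/
def GramLowerBound {n m : ℕ} (h : Euc n → Euc m) (mlow : ℝ) : Prop :=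
  ∀ (x : Euc n) (v : Euc m), mlow * ‖v‖ ^ 2 ≤ ⟪v, jac h x (jacT h x v)⟫_ℝ

/-- The feasible set `{x | h x = 0}`. -/
def feasibleSet {n m : ℕ} (h : Euc n → Euc m) : Set (Euc n) :=
  {x | h x = 0}

/-- The feasible set is connected and `f` is `ρ`-strongly convex in it. -/
structure StronglyConvexOnFeasible {n m : ℕ} (f : Euc n → ℝ) (h : Euc n → Euc m) (ρ : ℝ) :
    Prop where
  rho_pos : 0 < ρ
  connected : IsConnected (feasibleSet h)
  ineq : ∀ x ∈ feasibleSet h, ∀ y ∈ feasibleSet h,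
    f x + ⟪gradient f x, y - x⟫_ℝ + ρ / 2 * ‖y - x‖ ^ 2 ≤ f y

/-- The map `Φ(x) = [h(x); q(x)]`. -/
def normalMap {n m : ℕ} (h : Euc n → Euc m) (q : Euc n → Euc (n - m)) (x : Euc n) :
    EucPair m (n - m) :=
  WithLp.toLp 2 (h x, q x)

/-- `Φ = [h; q]` is a global diffeomorphism of `ℝⁿ` onto `ℝᵐ × ℝⁿ⁻ᵐ` with inverse `Ψ`, and `q` is
chosen as in the normal form: `∇ᵀq ∇h = 0` and `∇ᵀq ∇q = I` everywhere.
(`h` itself is assumed smooth separately.) -/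
structure IsNormalFormDiffeo {n m : ℕ} (h : Euc n → Euc m) (q : Euc n → Euc (n - m))
    (Ψ : EucPair m (n - m) → Euc n) : Prop where
  smooth_q : ContDiff ℝ ∞ q
  smooth_inv : ContDiff ℝ ∞ Ψ
  left_inv : ∀ x, Ψ (normalMap h q x) = x
  right_inv : ∀ ξ, normalMap h q (Ψ ξ) = ξ
  orthogonal : ∀ (x : Euc n) (v : Euc m), jac q x (jacT h x v) = 0
  orthonormal : ∀ (x : Euc n) (v : Euc (n - m)), jac q x (jacT q x v) = v

/-- `Φ` and its inverse `Ψ` are globally Lipschitz. -/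
def BiLipschitz {n m : ℕ} (h : Euc n → Euc m) (q : Euc n → Euc (n - m))
    (Ψ : EucPair m (n - m) → Euc n) : Prop :=
  (∃ L : ℝ≥0, LipschitzWith L (normalMap h q)) ∧ ∃ L : ℝ≥0, LipschitzWith L Ψ

/-- `‖∇ᵀq(x̃) ∇f(x̃) - ∇ᵀq(p) ∇f(p)‖ ≤ L₁ ‖y‖` for `x̃ = Φ⁻¹(y, η)` and `p = Φ⁻¹(0, η)`. -/
def TransverseLipschitz {n m : ℕ} (f : Euc n → ℝ) (q : Euc n → Euc (n - m))
    (Ψ : EucPair m (n - m) → Euc n) : Prop :=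
  ∃ L₁ : ℝ, 0 < L₁ ∧ ∀ (y : Euc m) (η : Euc (n - m)),
    ‖jac q (Ψ (WithLp.toLp 2 (y, η))) (gradient f (Ψ (WithLp.toLp 2 (y, η))))
      - jac q (Ψ (WithLp.toLp 2 (0, η))) (gradient f (Ψ (WithLp.toLp 2 (0, η))))‖ ≤ L₁ * ‖y‖

/-- `φ(x) = -(∇ᵀh(x) ∇h(x))⁻¹ (∇ᵀh(x) ∇f(x))`. The inverse is a true one under `FullRowRank`. -/
def multiplierMap {n m : ℕ} (f : Euc n → ℝ) (h : Euc n → Euc m) (x : Euc n) : Euc m :=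
  -((jac h x ∘L jacT h x).inverse (jac h x (gradient f x)))

/-- Right-hand side of the PI dynamics in the state `[x; z]`:
`ẋ = -∇f(x) - ∇h(x) (k_p h(x) + k_i z)`, `ż = h(x)`. -/
def piField {n m : ℕ} (f : Euc n → ℝ) (h : Euc n → Euc m) (kp ki : ℝ) (s : EucPair n m) :
    EucPair n m :=
  WithLp.toLp 2
    (-gradient f s.fst - jacT h s.fst (kp • h s.fst + ki • s.snd), h s.fst)

/-- The change of coordinates `[x; z] ↦ [x; λ]` with `λ = k_p h(x) + k_i z`. -/
def piCoord {n m : ℕ} (h : Euc n → Euc m) (kp ki : ℝ) (s : EucPair n m) : EucPair n m :=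
  WithLp.toLp 2 (s.fst, kp • h s.fst + ki • s.snd)

/-- The augmented Lagrangian `f(x) + λᵀ h(x) + (w/2) ‖h(x)‖²`. -/
def augLagrangian {n m : ℕ} (f : Euc n → ℝ) (h : Euc n → Euc m) (w : ℝ) (x : Euc n)
    (lam : Euc m) : ℝ :=
  f x + ⟪lam, h x⟫_ℝ + w / 2 * ‖h x‖ ^ 2

/-- Right-hand side of the primal-dual flow of the augmented Lagrangian in the state `[x; λ]`. -/
def almField {n m : ℕ} (f : Euc n → ℝ) (h : Euc n → Euc m) (w : ℝ) (s : EucPair n m) :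
    EucPair n m :=
  WithLp.toLp 2
    (-gradient (fun x => augLagrangian f h w x s.snd) s.fst,
      gradient (fun lam => augLagrangian f h w s.fst lam) s.snd)

/-- `γ` solves `γ' = F(γ)` on `[0, ∞)` (one-sided derivative at `0`). -/
def IsForwardSolution {X : Type*} [NormedAddCommGroup X] [NormedSpace ℝ X] (F : X → X)
    (γ : ℝ → X) : Prop :=
  ∀ t, 0 ≤ t → HasDerivWithinAt γ (F (γ t)) (Ici 0) t

/-- Expressed in the coordinates `T`, the point `p` is a globally exponentially stable equilibrium
of `s' = F(s)`: it is an equilibrium, solutions on `[0, ∞)` exist from every initial state, and all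
of them satisfy `‖T(s(t)) - p‖ ≤ c e^{-ρ t} ‖T(s(0)) - p‖`. -/
structure IsGloballyExpStable {X : Type*} [NormedAddCommGroup X] [NormedSpace ℝ X]
    (F : X → X) (T : X → X) (p : X) : Prop where
  equilibrium : ∃ e, T e = p ∧ F e = 0
  complete : ∀ s₀, ∃ γ, IsForwardSolution F γ ∧ γ 0 = s₀
  decay : ∃ c ρ : ℝ, 0 < c ∧ 0 < ρ ∧ ∀ γ, IsForwardSolution F γ →
    ∀ t, 0 ≤ t → ‖T (γ t) - p‖ ≤ c * Real.exp (-ρ * t) * ‖T (γ 0) - p‖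

end

/-! Write `λ = k_p h(x) + k_i z` and use the errors `l = λ - λ⋆`, `w = k_i z - λ⋆`, `e = q(x) -
q(x⋆)`, so that `k_p h(x) = l - w`. With `G = ∇ᵀh ∇h`, the definition of `φ` gives `∇ᵀh ∇f = -G φ`,
and `∇ᵀq ∇h = 0` removes the multiplier from the tangential equation: `l' = -k_p G l + k_p G (φ(x) -
λ⋆) + k_i h`, `w' = k_i h`, `e' = -∇ᵀq ∇f`.

The geometry is rigid: since `∇ᵀq ∇q = I`, the map `η ↦ Ψ(0, η)` is an isometry, hence affine, and
the feasible set is an affine subspace (`inv_zero_sub`). Strong convexity thus passes to the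
coordinate `η`. It yields the minimizer by coercivity, and makes the tangential gradient strongly
monotone up to an error of order `‖e‖ ‖h‖` (`inner_tangential_gradient_ge`).

After division by `k_p`, the `(l, w)` block depends on the gains only through `κ = k_i / k_p²`. For
all `0 < κ < m` it admits a quadratic form whose decay rate and disturbance gain do not depend on
`κ` (`exists_multiplier_form`); this is why the threshold on `k_p` is independent of `k_i`. The
disturbance `φ(x) - λ⋆` is at most of order `‖h‖ + ‖e‖`, where `‖h‖ = ‖l - w‖ / k_p` is small for
large `k_p` and `e` is paid for by the tangential dissipation (`small_gain`). The resulting Lyapunov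
function is comparable to the squared distance to equilibrium, and its bounded sublevel sets exclude
finite-time blow-up.

The augmented Lagrangian flow is the case `k_i = 1`, `k_p = w` with `z` read as the multiplier; the
two systems of coordinates have comparable errors because `h` is Lipschitz and vanishes at `x⋆`. -/

/-! ### Global existence and exponential decay for autonomous equations -/

section ODE

open Filter Topology

variable {E : Type*} [NormedAddCommGroup E] [NormedSpace ℝ E]

/-- A bounded Lipschitz vector field has a solution on `[0, ∞)` from every initial point. -/
theorem exists_forwardSolution_of_lipschitzWith [CompleteSpace E] {F : E → E} {K B : ℝ≥0}
    (hF : LipschitzWith K F) (hB : ∀ x, ‖F x‖ ≤ B) (s₀ : E) :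
    ∃ γ, IsForwardSolution F γ ∧ γ 0 = s₀ := by
  have hex : ∀ N : ℕ, ∃ α : ℝ → E, α 0 = s₀ ∧
      ∀ t ∈ Icc (0 : ℝ) (N + 1), HasDerivWithinAt α (F (α t)) (Icc (0 : ℝ) (N + 1)) t := by
    intro N
    have h0 : (0 : ℝ) ∈ Icc (0 : ℝ) (N + 1) := ⟨le_rfl, by positivity⟩
    -- A field bounded by `B` moves a point by at most `B * (N + 1)` in this time, so a ball of that
    -- radius suffices and the interval can be arbitrarily long.
    have hP : IsPicardLindelof (fun _ => F) (⟨0, h0⟩ : Icc (0 : ℝ) (N + 1)) s₀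
        (B * (N + 1)) 0 B K :=
      IsPicardLindelof.of_time_independent (fun x _ => hB x) hF.lipschitzOnWith (by
        have : (0 : ℝ) ≤ N + 1 := by positivity
        simp [this])
    exact hP.exists_eq_forall_mem_Icc_hasDerivWithinAt₀
  choose α hα0 hα using hex
  have hIci : ∀ (N : ℕ) (t : ℝ), t ∈ Ico (0 : ℝ) (N + 1) →
      HasDerivWithinAt (α N) (F (α N t)) (Ici 0) t := by
    intro N t ht
    refine (hα N t ⟨ht.1, ht.2.le⟩).mono_of_mem_nhdsWithin ?_
    filter_upwards [self_mem_nhdsWithin, mem_nhdsWithin_of_mem_nhds (Iio_mem_nhds ht.2)]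
      with s h1 h2 using ⟨h1, le_of_lt h2⟩
  have huniq : ∀ N M : ℕ, N ≤ M → EqOn (α N) (α M) (Icc (0 : ℝ) (N + 1)) := by
    intro N M hNM
    have hNM' : (N : ℝ) + 1 ≤ M + 1 := by exact_mod_cast Nat.succ_le_succ hNM
    refine ODE_solution_unique (v := fun _ => F) (K := K) (fun _ => hF)
      (fun t ht => (hα N t ht).continuousWithinAt)
      (fun t ht => (hIci N t ht).mono (Ici_subset_Ici.2 ht.1))
      (fun t ht => (hα M t ⟨ht.1, ht.2.trans hNM'⟩).continuousWithinAt.mono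
        (Icc_subset_Icc_right hNM'))
      (fun t ht => (hIci M t ⟨ht.1, ht.2.trans_le hNM'⟩).mono (Ici_subset_Ici.2 ht.1))
      ((hα0 N).trans (hα0 M).symm)
  have hlt : ∀ t : ℝ, t < (⌈t⌉₊ : ℝ) + 1 := fun t => (Nat.le_ceil t).trans_lt (lt_add_one _)
  have heq : ∀ (N : ℕ) (t : ℝ), 0 ≤ t → t ≤ N → α ⌈t⌉₊ t = α N t := fun N t h0 hN =>
    huniq _ _ (Nat.ceil_le.2 hN) ⟨h0, (hlt t).le⟩
  refine ⟨fun t => α ⌈t⌉₊ t, fun t ht => ?_, by simp [hα0]⟩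
  -- The ceiling may jump just after `t`; the branch with index `⌈t⌉₊ + 1` agrees with the glued
  -- function on a whole neighbourhood of `t` in `[0, ∞)`.
  have hd := hIci (⌈t⌉₊ + 1) t ⟨ht, (hlt t).trans (by push_cast; linarith)⟩
  have hval : α ⌈t⌉₊ t = α (⌈t⌉₊ + 1) t :=
    heq _ t ht ((Nat.le_ceil t).trans (by push_cast; linarith))
  simp only [hval]
  refine hd.congr_of_eventuallyEq ?_ hval
  filter_upwards [self_mem_nhdsWithin, mem_nhdsWithin_of_mem_nhds (Iio_mem_nhds (hlt t))]
    with s h1 h2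
  exact heq _ s h1 (by push_cast; exact le_of_lt h2)

/-- The product `exp (r t) * u t` has nonpositive derivative. No sign is imposed on `r`; the case `r
= 0` is plain monotonicity. -/
theorem le_mul_exp_of_hasDerivWithinAt {u u' : ℝ → ℝ} {r : ℝ}
    (hu : ∀ t, 0 ≤ t → HasDerivWithinAt u (u' t) (Ici 0) t)
    (hle : ∀ t, 0 ≤ t → u' t ≤ -r * u t) {t : ℝ} (ht : 0 ≤ t) :
    u t ≤ u 0 * Real.exp (-r * t) := by
  have hd : ∀ s, 0 ≤ s → HasDerivWithinAt (fun s => Real.exp (r * s) * u s)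
      (Real.exp (r * s) * r * u s + Real.exp (r * s) * u' s) (Ici 0) s := by
    intro s hs
    have h1 : HasDerivAt (fun s : ℝ => Real.exp (r * s)) (Real.exp (r * s) * r) s := by
      simpa using ((hasDerivAt_id s).const_mul r).exp
    exact h1.hasDerivWithinAt.mul (hu s hs)
  have hanti : AntitoneOn (fun s => Real.exp (r * s) * u s) (Ici 0) := by
    have hint : ∀ s ∈ interior (Ici (0 : ℝ)), HasDerivAt (fun s => Real.exp (r * s) * u s)
        (Real.exp (r * s) * r * u s + Real.exp (r * s) * u' s) s := by
      intro s hs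
      rw [interior_Ici] at hs
      exact (hd s (le_of_lt hs)).hasDerivAt (Ici_mem_nhds hs)
    refine antitoneOn_of_deriv_nonpos (convex_Ici 0)
      (fun s hs => (hd s hs).continuousWithinAt)
      (fun s hs => (hint s hs).differentiableAt.differentiableWithinAt) (fun s hs => ?_)
    rw [(hint s hs).deriv]
    have h0 : 0 ≤ s := interior_subset hs
    nlinarith [hle s h0, Real.exp_pos (r * s)]
  have h := hanti (mem_Ici.2 le_rfl) (mem_Ici.2 ht) ht
  simp only [mul_zero, Real.exp_zero, one_mul] at h
  have he : Real.exp (-r * t) * Real.exp (r * t) = 1 := by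
    rw [← Real.exp_add]; simp
  calc u t = (Real.exp (-r * t) * Real.exp (r * t)) * u t := by rw [he, one_mul]
    _ = Real.exp (-r * t) * (Real.exp (r * t) * u t) := by ring
    _ ≤ Real.exp (-r * t) * u 0 := by gcongr
    _ = _ := mul_comm _ _

/-- A function whose derivative along a smooth vector field is nonpositive and whose sublevel sets
are bounded forces global existence of solutions forward in time. -/
theorem exists_forwardSolution_of_lyapunov [FiniteDimensional ℝ E]
    {F : E → E} (hF : ContDiff ℝ ∞ F) {W : E → ℝ} {W' : E → E →L[ℝ] ℝ}
    (hW : ∀ s, HasFDerivAt W (W' s) s) (hdec : ∀ s, W' s (F s) ≤ 0)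
    (hbdd : ∀ c, Bornology.IsBounded {s | W s ≤ c}) (s₀ : E) :
    ∃ γ, IsForwardSolution F γ ∧ γ 0 = s₀ := by
  have : CompleteSpace E := FiniteDimensional.complete ℝ E
  obtain ⟨R, hR⟩ := (hbdd (W s₀)).subset_closedBall (0 : E)
  have hpos : 0 < max R 1 := lt_max_of_lt_right one_pos
  -- Cutting off outside the initial sublevel set makes the field bounded and Lipschitz. As `χ ≥ 0`,
  -- `W` still decreases along it, so the solution stays where `χ = 1` and solves the original
  -- equation.
  let χ : ContDiffBump (0 : E) := ⟨max R 1, max R 1 + 1, hpos, lt_add_one _⟩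
  have hsmooth : ContDiff ℝ ∞ (fun s => χ s • F s) := χ.contDiff.smul hF
  have hcomp : HasCompactSupport (fun s => χ s • F s) := χ.hasCompactSupport.smul_right
  obtain ⟨K, hK⟩ := hsmooth.lipschitzWith_of_hasCompactSupport hcomp (by simp)
  obtain ⟨B, hB⟩ := hcomp.exists_bound_of_continuous hsmooth.continuous
  obtain ⟨γ, hγ, hγ0⟩ := exists_forwardSolution_of_lipschitzWith (B := B.toNNReal) hK
    (fun x => (hB x).trans (Real.le_coe_toNNReal B)) s₀
  refine ⟨γ, fun t ht => ?_, hγ0⟩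
  have hmem : W (γ t) ≤ W s₀ := by
    have := le_mul_exp_of_hasDerivWithinAt (u := W ∘ γ) (r := 0)
      (fun t ht => (hW (γ t)).comp_hasDerivWithinAt t (hγ t ht))
      (fun t ht => by
        simp only [map_smul, smul_eq_mul, neg_zero, zero_mul]
        exact mul_nonpos_of_nonneg_of_nonpos χ.nonneg (hdec _)) ht
    simpa [hγ0] using this
  have h1 : χ (γ t) = 1 := by
    apply χ.one_of_mem_closedBall
    exact Metric.closedBall_subset_closedBall (le_max_left _ _) (hR hmem)
  have := hγ t ht
  simpa only [h1, one_smul] using this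

end ODE

/-! ### Quadratic Lyapunov forms and the small-gain estimate -/

section QuadraticForms

/-- Dissipation of the multiplier block for slow integral action. -/
theorem slow_dissipation {m M κ l z p P i : ℝ} (hm : 0 < m) (hκ : 0 < κ)
    (hκm : κ ≤ m / 2) (hP : m * l ^ 2 ≤ P) (hi : |i| ≤ l * z) :
    4 / m * (-P + l * (M * p) + κ * l ^ 2 - κ * i) + 1 / κ * (κ * (i - z ^ 2)) ≤
      -(1 / 2) * (l ^ 2 + z ^ 2) + 4 * M ^ 2 / m ^ 2 * p ^ 2 := by
  have h1 : 1 / κ * (κ * (i - z ^ 2)) = i - z ^ 2 := by field_simp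
  have hκ4 : 4 / m * κ ≤ 2 := by
    rw [div_mul_eq_mul_div, div_le_iff₀ hm]; linarith
  have hκ0 : 0 ≤ 4 / m * κ := by positivity
  have h2 : 4 / m * (m * l ^ 2) ≤ 4 / m * P := by gcongr
  have h3 : 4 / m * (m * l ^ 2) = 4 * l ^ 2 := by field_simp
  have h4 : 4 / m * κ * l ^ 2 ≤ 2 * l ^ 2 := by gcongr
  -- The weight `1 / κ` contributes `i` and the weight `4 / m` contributes `-(4 / m) κ i`; `κ ≤ m /
  -- 2` keeps the total coefficient in `[-1, 1]`.
  have h5 : (1 - 4 / m * κ) * i ≤ l * z := by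
    refine (le_abs_self _).trans ?_
    rw [abs_mul]
    have : |1 - 4 / m * κ| ≤ 1 := abs_le.2 ⟨by linarith, by linarith⟩
    calc _ ≤ 1 * (l * z) := mul_le_mul this hi (abs_nonneg _) zero_le_one
      _ = _ := one_mul _
  have h6 : 4 / m * (l * (M * p)) ≤ l ^ 2 + 4 * M ^ 2 / m ^ 2 * p ^ 2 := by
    have := sq_nonneg (l - 2 * M / m * p)
    have e1 : (l - 2 * M / m * p) ^ 2 =
      l ^ 2 - 4 / m * (l * (M * p)) + 4 * M ^ 2 / m ^ 2 * p ^ 2 := by ring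
    linarith
  rw [h1]
  nlinarith [sq_nonneg (l - z)]

/-- Dissipation of the multiplier block for fast integral action. -/
theorem fast_dissipation {m M κ l z p P i δ : ℝ} (hm : 0 < m) (hmM : m ≤ M)
    (hκ : m / 2 ≤ κ) (hκm : κ < m) (hδ : δ = m ^ 2 / (16 * M ^ 2)) (hP : m * l ^ 2 ≤ P) :
    1 * (-P + l * (M * p) + κ * l ^ 2 - κ * i) + 1 * (κ * (i - z ^ 2)) +
        δ * (M * l * z + M * p * z + κ * z ^ 2 - κ * l ^ 2) ≤
      -(δ * m / 8) * (l ^ 2 + z ^ 2) + (2 * M ^ 2 / (δ * m) + 2 * δ ^ 2 * M ^ 2 / m) * p ^ 2 := by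
  have hM : 0 < M := hm.trans_le hmM
  have hδ0 : 0 < δ := by rw [hδ]; positivity
  -- The value of `δ` is fixed by this identity: the coupling `δ M l z` then costs only `m / 8` of
  -- the decay in `z`.
  have hδM : δ * (2 * M ^ 2 / m) = m / 8 := by rw [hδ]; field_simp; norm_num
  have hδ1 : δ ≤ 1 / 16 := by
    rw [hδ, div_le_div_iff₀ (by positivity) (by positivity)]
    nlinarith [mul_self_le_mul_self hm.le hmM]
  have h1 : l * (M * p) ≤ δ * m / 8 * l ^ 2 + 2 * M ^ 2 / (δ * m) * p ^ 2 := by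
    have := mul_nonneg (show 0 ≤ δ * m / 8 by positivity)
      (sq_nonneg (l - 4 * M / (δ * m) * p))
    have e1 : δ * m / 8 * (l - 4 * M / (δ * m) * p) ^ 2 =
      δ * m / 8 * l ^ 2 - l * (M * p) + 2 * M ^ 2 / (δ * m) * p ^ 2 := by
      field_simp; ring
    linarith
  have h2 : δ * (M * l * z) ≤ δ * m / 8 * l ^ 2 + m / 8 * z ^ 2 := by
    have := mul_nonneg (show 0 ≤ δ * m / 8 by positivity)
      (sq_nonneg (l - 4 * M / m * z))
    have e1 : δ * m / 8 * (l - 4 * M / m * z) ^ 2 =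
      δ * m / 8 * l ^ 2 - δ * (M * l * z) + δ * (2 * M ^ 2 / m) * z ^ 2 := by
      field_simp; ring
    rw [hδM] at e1
    linarith
  have h3 : δ * (M * p * z) ≤ m / 8 * z ^ 2 + 2 * δ ^ 2 * M ^ 2 / m * p ^ 2 := by
    have := mul_nonneg (show 0 ≤ m / 8 by positivity)
      (sq_nonneg (z - 4 * δ * M / m * p))
    have e1 : m / 8 * (z - 4 * δ * M / m * p) ^ 2 =
      m / 8 * z ^ 2 - δ * (M * p * z) + 2 * δ ^ 2 * M ^ 2 / m * p ^ 2 := by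
      field_simp; ring
    linarith
  -- The diagonal terms leave only `(κ - m) l² ≤ 0`, with no margin as `κ` tends to `m`; the decay
  -- in `l` comes from the cross term.
  have h4 : δ * (m / 2) * l ^ 2 ≤ δ * κ * l ^ 2 := by gcongr
  have h5 : (1 - δ) * (m / 2) * z ^ 2 ≤ (1 - δ) * κ * z ^ 2 := by
    have : 0 ≤ 1 - δ := by linarith
    gcongr
  have h6 : κ * l ^ 2 ≤ m * l ^ 2 := by gcongr
  have h7 : δ * (m * z ^ 2) ≤ 1 / 16 * (m * z ^ 2) := by gcongr
  have h8 : 0 ≤ m * z ^ 2 := by positivity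
  have h9 : 0 ≤ δ * m * l ^ 2 := by positivity
  linarith

variable {E E' : Type*} [NormedAddCommGroup E] [InnerProductSpace ℝ E]
  [NormedAddCommGroup E']

/-- A quadratic form for the multiplier block whose dissipation rate does not depend on the ratio
`κ` of the gains, as long as `κ` stays below the lower bound of the Gram matrix. -/
theorem exists_multiplier_form {m M : ℝ} (hm : 0 < m) (hmM : m ≤ M) :
    ∃ c C : ℝ, 0 < c ∧ 0 < C ∧ ∀ κ, 0 < κ → κ < m → ∃ a b δ c₀ : ℝ, 0 < c₀ ∧
      (∀ l w : E, c₀ * (‖l‖ ^ 2 + ‖w‖ ^ 2) ≤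
        a / 2 * ‖l‖ ^ 2 + b / 2 * ‖w‖ ^ 2 - δ * ⟪l, w⟫_ℝ) ∧
      ∀ (l w u v : E) (p : ℝ), m * ‖l‖ ^ 2 ≤ ⟪l, u⟫_ℝ → ‖u‖ ≤ M * ‖l‖ → ‖v‖ ≤ M * p →
        a * ⟪l, -u + v + κ • (l - w)⟫_ℝ + b * ⟪w, κ • (l - w)⟫_ℝ
          - δ * (⟪-u + v + κ • (l - w), w⟫_ℝ + ⟪l, κ • (l - w)⟫_ℝ) ≤
        -c * (‖l‖ ^ 2 + ‖w‖ ^ 2) + C * p ^ 2 := by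
  have hM : 0 < M := hm.trans_le hmM
  obtain ⟨δ, hδ⟩ : ∃ δ, δ = m ^ 2 / (16 * M ^ 2) := ⟨_, rfl⟩
  have hδ0 : 0 < δ := by rw [hδ]; positivity
  have hδ1 : δ ≤ 1 / 16 := by
    rw [hδ, div_le_div_iff₀ (by positivity) (by positivity)]
    nlinarith [mul_self_le_mul_self hm.le hmM]
  -- The worse rate and the worse gain of the two regimes, fixed before `κ`; only the form itself
  -- may depend on `κ`.
  refine ⟨min (1 / 2) (δ * m / 8),
    max (4 * M ^ 2 / m ^ 2) (2 * M ^ 2 / (δ * m) + 2 * δ ^ 2 * M ^ 2 / m),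
    by positivity, by positivity, fun κ hκ hκm => ?_⟩
  have hcs : ∀ l w : E, |⟪l, w⟫_ℝ| ≤ ‖l‖ * ‖w‖ := abs_real_inner_le_norm
  -- For small `κ`, the weight `1 / κ` keeps the decay of `w` uniform. For `κ` near `m`, equal
  -- weights cancel the coupling `κ ⟪l, w⟫`, and a small cross term restores the decay of `l`.
  rcases le_total κ (m / 2) with hκ2 | hκ2
  · refine ⟨4 / m, 1 / κ, 0, min (2 / m) (1 / (2 * κ)), by positivity, fun l w => ?_, ?_⟩
    · have h1 : min (2 / m) (1 / (2 * κ)) * ‖l‖ ^ 2 ≤ 2 / m * ‖l‖ ^ 2 := by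
        gcongr; exact min_le_left _ _
      have h2 : min (2 / m) (1 / (2 * κ)) * ‖w‖ ^ 2 ≤ 1 / (2 * κ) * ‖w‖ ^ 2 := by
        gcongr; exact min_le_right _ _
      have e1 : 4 / m / 2 = 2 / m := by ring
      have e2 : 1 / κ / 2 = 1 / (2 * κ) := by ring
      rw [e1, e2]
      linarith
    · intro l w u v p hlu _ hv
      have h := slow_dissipation (p := p) (M := M) (z := ‖w‖) hm hκ hκ2 hlu (hcs l w)
      have hlv : ⟪l, v⟫_ℝ ≤ ‖l‖ * (M * p) :=
        (real_inner_le_norm l v).trans (by gcongr)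
      have h1 : 4 / m * ⟪l, v⟫_ℝ ≤ 4 / m * (‖l‖ * (M * p)) := by gcongr
      have h2 : min (1 / 2) (δ * m / 8) * (‖l‖ ^ 2 + ‖w‖ ^ 2) ≤ 1 / 2 * (‖l‖ ^ 2 + ‖w‖ ^ 2) := by
        gcongr; exact min_le_left _ _
      have h3 : 4 * M ^ 2 / m ^ 2 * p ^ 2 ≤
          max (4 * M ^ 2 / m ^ 2) (2 * M ^ 2 / (δ * m) + 2 * δ ^ 2 * M ^ 2 / m) * p ^ 2 := by
        gcongr; exact le_max_left _ _
      simp only [inner_add_right, inner_neg_right, inner_smul_right, inner_sub_right,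
        real_inner_self_eq_norm_sq, real_inner_comm l w, zero_mul, sub_zero]
      linarith
  · refine ⟨1, 1, δ, 1 / 4, by positivity, fun l w => ?_, ?_⟩
    · have h1 : δ * ⟪l, w⟫_ℝ ≤ 1 / 16 * (‖l‖ * ‖w‖) :=
        (mul_le_mul_of_nonneg_left (real_inner_le_norm l w) hδ0.le).trans (by gcongr)
      nlinarith [sq_nonneg (‖l‖ - ‖w‖), sq_nonneg ‖l‖, sq_nonneg ‖w‖]
    · intro l w u v p hlu hu hv
      have h := fast_dissipation (p := p) (z := ‖w‖) (i := ⟪l, w⟫_ℝ) hm hmM hκ2 hκm hδ hlu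
      have hlv : ⟪l, v⟫_ℝ ≤ ‖l‖ * (M * p) :=
        (real_inner_le_norm l v).trans (by gcongr)
      have huw : ⟪u, w⟫_ℝ ≤ M * ‖l‖ * ‖w‖ :=
        (real_inner_le_norm u w).trans (by gcongr)
      have hvw : -⟪v, w⟫_ℝ ≤ M * p * ‖w‖ :=
        (neg_le_abs _).trans ((hcs v w).trans (by gcongr))
      have h1 : δ * (⟪u, w⟫_ℝ - ⟪v, w⟫_ℝ) ≤ δ * (M * ‖l‖ * ‖w‖ + M * p * ‖w‖) := by
        gcongr; linarith
      have h2 : min (1 / 2) (δ * m / 8) * (‖l‖ ^ 2 + ‖w‖ ^ 2) ≤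
          δ * m / 8 * (‖l‖ ^ 2 + ‖w‖ ^ 2) := by
        gcongr; exact min_le_right _ _
      have h3 : (2 * M ^ 2 / (δ * m) + 2 * δ ^ 2 * M ^ 2 / m) * p ^ 2 ≤
          max (4 * M ^ 2 / m ^ 2) (2 * M ^ 2 / (δ * m) + 2 * δ ^ 2 * M ^ 2 / m) * p ^ 2 := by
        gcongr; exact le_max_right _ _
      simp only [inner_add_right, inner_neg_right, inner_smul_right, inner_sub_right,
        inner_add_left, inner_neg_left, inner_smul_left, inner_sub_left,
        real_inner_self_eq_norm_sq, real_inner_comm l w, conj_trivial]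
      linarith

/-- The quadratic Lyapunov function of the multiplier, integrator and tangential errors. -/
noncomputable def lyapunovForm (a b δ σ : ℝ) (l w : E) (e : E') : ℝ :=
  a / 2 * ‖l‖ ^ 2 + b / 2 * ‖w‖ ^ 2 - δ * ⟪l, w⟫_ℝ + σ / 2 * ‖e‖ ^ 2

theorem lyapunovForm_le (a b δ σ : ℝ) (l w : E) (e : E') :
    lyapunovForm a b δ σ l w e ≤
      (|a| + |b| + |δ| + |σ|) * (‖l‖ ^ 2 + ‖w‖ ^ 2 + ‖e‖ ^ 2) := by
  have h1 : -(δ * ⟪l, w⟫_ℝ) ≤ |δ| * (‖l‖ * ‖w‖) := by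
    refine (neg_le_abs _).trans ?_
    rw [abs_mul]
    gcongr
    exact abs_real_inner_le_norm l w
  have h2 : |δ| * (‖l‖ * ‖w‖) ≤ |δ| * (‖l‖ ^ 2 + ‖w‖ ^ 2) := by
    gcongr
    nlinarith [sq_nonneg (‖l‖ - ‖w‖), sq_nonneg ‖l‖, sq_nonneg ‖w‖]
  have ha : a * ‖l‖ ^ 2 ≤ |a| * ‖l‖ ^ 2 := by gcongr; exact le_abs_self a
  have hb : b * ‖w‖ ^ 2 ≤ |b| * ‖w‖ ^ 2 := by gcongr; exact le_abs_self b
  have hs : σ * ‖e‖ ^ 2 ≤ |σ| * ‖e‖ ^ 2 := by gcongr; exact le_abs_self σ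
  have p1 : 0 ≤ |a| * ‖l‖ ^ 2 := by positivity
  have p2 : 0 ≤ |a| * ‖w‖ ^ 2 := by positivity
  have p3 : 0 ≤ |a| * ‖e‖ ^ 2 := by positivity
  have p4 : 0 ≤ |b| * ‖l‖ ^ 2 := by positivity
  have p5 : 0 ≤ |b| * ‖w‖ ^ 2 := by positivity
  have p6 : 0 ≤ |b| * ‖e‖ ^ 2 := by positivity
  have p7 : 0 ≤ |δ| * ‖e‖ ^ 2 := by positivity
  have p8 : 0 ≤ |σ| * ‖l‖ ^ 2 := by positivity
  have p9 : 0 ≤ |σ| * ‖w‖ ^ 2 := by positivity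
  have p0 : 0 ≤ |σ| * ‖e‖ ^ 2 := by positivity
  unfold lyapunovForm
  linarith

variable [InnerProductSpace ℝ E']

/-- Its derivative in the direction `(l', w', e')`. -/
noncomputable def lyapunovFormDeriv (a b δ σ : ℝ) (l w : E) (e : E') (l' w' : E) (e' : E') : ℝ :=
  a * ⟪l, l'⟫_ℝ + b * ⟪w, w'⟫_ℝ - δ * (⟪l', w⟫_ℝ + ⟪l, w'⟫_ℝ) + σ * ⟪e, e'⟫_ℝ

/-- Small-gain estimate combining the multiplier block with the tangential block. -/
theorem small_gain {c C L L₁ ρ kp S T p Y ε N : ℝ} (hc : 0 < c) (hC : 0 < C) (hL : 0 < L)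
    (hρ : 0 < ρ) (hkp : 1 + 4 * (2 * C * L ^ 2 + 4 * C * L ^ 2 * L₁ ^ 2 / ρ ^ 2) / c < kp)
    (hp0 : 0 ≤ p) (hT : T ≤ -c * S + C * p ^ 2) (hp : p ≤ L * (Y + ε))
    (hY : kp ^ 2 * Y ^ 2 ≤ 2 * S) (hN : ρ * ε ^ 2 - L₁ * (ε * Y) ≤ N) :
    kp * T - 8 * kp * C * L ^ 2 / ρ * N ≤ -(kp * c / 2) * S - 2 * kp * C * L ^ 2 * ε ^ 2 := by
  obtain ⟨Q, hQ⟩ : ∃ Q, Q = 2 * C * L ^ 2 + 4 * C * L ^ 2 * L₁ ^ 2 / ρ ^ 2 := ⟨_, rfl⟩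
  rw [← hQ] at hkp
  have hQ0 : 0 ≤ Q := by rw [hQ]; positivity
  have hkp1 : 1 < kp := lt_of_le_of_lt (le_add_of_nonneg_right (by positivity)) hkp
  have hkp0 : 0 < kp := zero_lt_one.trans hkp1
  -- The threshold gives both `kp > 1` and `kp > 4 * Q / c`; their product is the quadratic bound.
  have hkc : 4 * Q ≤ c * kp ^ 2 := by
    have h1 : 4 * Q / c < kp := by linarith
    rw [div_lt_iff₀ hc] at h1
    nlinarith [mul_pos hc hkp0]
  have hYS : Q * Y ^ 2 ≤ c / 2 * S := by
    have h1 : 4 * Q * Y ^ 2 ≤ c * kp ^ 2 * Y ^ 2 := by gcongr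
    have h2 : c * (kp ^ 2 * Y ^ 2) ≤ c * (2 * S) := by gcongr
    linarith
  have hp2 : p ^ 2 ≤ 2 * L ^ 2 * (Y ^ 2 + ε ^ 2) := by
    calc p ^ 2 ≤ (L * (Y + ε)) ^ 2 := by gcongr
      _ ≤ _ := by nlinarith [mul_nonneg (sq_nonneg L) (sq_nonneg (Y - ε))]
  have hN2 : ρ / 2 * ε ^ 2 - L₁ ^ 2 / (2 * ρ) * Y ^ 2 ≤ N := by
    have h := mul_nonneg (show 0 ≤ ρ / 2 by positivity) (sq_nonneg (ε - L₁ / ρ * Y))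
    have e1 : ρ / 2 * (ε - L₁ / ρ * Y) ^ 2 =
      ρ / 2 * ε ^ 2 - L₁ * (ε * Y) + L₁ ^ 2 / (2 * ρ) * Y ^ 2 := by
      field_simp
      ring
    linarith
  have h1 : kp * T ≤ kp * (-c * S + C * (2 * L ^ 2 * (Y ^ 2 + ε ^ 2))) := by
    gcongr
    refine hT.trans ?_
    gcongr
  have h2 : 8 * kp * C * L ^ 2 / ρ * (ρ / 2 * ε ^ 2 - L₁ ^ 2 / (2 * ρ) * Y ^ 2) ≤
      8 * kp * C * L ^ 2 / ρ * N := by gcongr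
  have e2 : 8 * kp * C * L ^ 2 / ρ * (ρ / 2 * ε ^ 2 - L₁ ^ 2 / (2 * ρ) * Y ^ 2) =
      4 * kp * C * L ^ 2 * ε ^ 2 - kp * (4 * C * L ^ 2 * L₁ ^ 2 / ρ ^ 2) * Y ^ 2 := by
    field_simp
    ring
  have h3 : kp * (Q * Y ^ 2) ≤ kp * (c / 2 * S) := by gcongr
  rw [hQ] at h3
  rw [e2] at h2
  linarith

/-- A quadratic Lyapunov function for the interconnected error dynamics. The threshold for `kp`
does not depend on `ki`. -/
theorem exists_lyapunovForm {m M L L₁ ρ : ℝ} (hm : 0 < m) (hmM : m ≤ M) (hL : 0 < L)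
    (hρ : 0 < ρ) :
    ∃ kpStar : ℝ, 0 < kpStar ∧ ∀ kp ki : ℝ, kpStar < kp → 0 < ki → ki < m * kp ^ 2 →
      ∃ a b δ σ c₀ r : ℝ, 0 < c₀ ∧ 0 < r ∧
        (∀ (l w : E) (e : E'), c₀ * (‖l‖ ^ 2 + ‖w‖ ^ 2 + ‖e‖ ^ 2) ≤ lyapunovForm a b δ σ l w e) ∧
        ∀ (l w y u v : E) (e N : E') (p : ℝ), kp • y = l - w → m * ‖l‖ ^ 2 ≤ ⟪l, u⟫_ℝ →
          ‖u‖ ≤ M * ‖l‖ → 0 ≤ p → ‖v‖ ≤ M * p → p ≤ L * (‖y‖ + ‖e‖) →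
          ρ * ‖e‖ ^ 2 - L₁ * (‖e‖ * ‖y‖) ≤ ⟪e, N⟫_ℝ →
          lyapunovFormDeriv a b δ σ l w e (-(kp • u) + kp • v + ki • y) (ki • y) (-N) ≤
            -r * lyapunovForm a b δ σ l w e := by
  obtain ⟨c, C, hc, hC, hform⟩ := exists_multiplier_form (E := E) hm hmM
  refine ⟨1 + 4 * (2 * C * L ^ 2 + 4 * C * L ^ 2 * L₁ ^ 2 / ρ ^ 2) / c, by positivity,
    fun kp ki hkp hki hkim => ?_⟩
  have hkp0 : 0 < kp := lt_trans (by positivity) hkp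
  -- With time rescaled by `kp`, the integral term is `(ki / kp) • y = (ki / kp ^ 2) • (l - w)`, so
  -- the gain condition says `κ < m`.
  obtain ⟨a, b, δ, c₀, hc₀, hpos, hdis⟩ := hform (ki / kp ^ 2) (by positivity)
    ((div_lt_iff₀ (by positivity)).2 hkim)
  -- With this weight half of the tangential dissipation, `σ * ρ / 2`, equals `4 * kp * C * L ^ 2`,
  -- twice what the disturbance `p` takes from `‖e‖ ^ 2`.
  obtain ⟨σ, hσ⟩ : ∃ σ, σ = 8 * kp * C * L ^ 2 / ρ := ⟨_, rfl⟩
  have hσ0 : 0 < σ := by rw [hσ]; positivity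
  obtain ⟨B, hB⟩ : ∃ B, B = |a| + |b| + |δ| + |σ| := ⟨_, rfl⟩
  have hB0 : 0 < B := by
    have := abs_pos.2 hσ0.ne'
    rw [hB]; positivity
  obtain ⟨d, hd⟩ : ∃ d, d = min (kp * c / 2) (2 * kp * C * L ^ 2) := ⟨_, rfl⟩
  have hd0 : 0 < d := by rw [hd]; positivity
  refine ⟨a, b, δ, σ, min c₀ (σ / 2), d / B, by positivity, by positivity, fun l w e => ?_, ?_⟩
  · have h1 : min c₀ (σ / 2) * (‖l‖ ^ 2 + ‖w‖ ^ 2) ≤ c₀ * (‖l‖ ^ 2 + ‖w‖ ^ 2) := by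
      gcongr; exact min_le_left _ _
    have h2 : min c₀ (σ / 2) * ‖e‖ ^ 2 ≤ σ / 2 * ‖e‖ ^ 2 := by
      gcongr; exact min_le_right _ _
    unfold lyapunovForm
    linarith [hpos l w]
  · intro l w y u v e N p hy hlu hu hp0 hv hp hN
    have hT := hdis l w u v p hlu hu hv
    have hkiy : ki • y = kp • ((ki / kp ^ 2) • (l - w)) := by
      rw [← hy, smul_smul, smul_smul]
      congr 1
      field_simp
    have hY : kp ^ 2 * ‖y‖ ^ 2 ≤ 2 * (‖l‖ ^ 2 + ‖w‖ ^ 2) := by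
      have h1 : kp * ‖y‖ = ‖l - w‖ := by
        rw [← hy, norm_smul, Real.norm_of_nonneg hkp0.le]
      rw [← mul_pow, h1]
      calc ‖l - w‖ ^ 2 ≤ (‖l‖ + ‖w‖) ^ 2 := by gcongr; exact norm_sub_le l w
        _ ≤ _ := by nlinarith [sq_nonneg (‖l‖ - ‖w‖)]
    have hgain := small_gain hc hC hL hρ hkp hp0 hT hp hY hN
    have hle := lyapunovForm_le a b δ σ l w e
    rw [← hB] at hle
    have hrw : lyapunovFormDeriv a b δ σ l w e (-(kp • u) + kp • v + ki • y) (ki • y) (-N) =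
        kp * (a * ⟪l, -u + v + (ki / kp ^ 2) • (l - w)⟫_ℝ + b * ⟪w, (ki / kp ^ 2) • (l - w)⟫_ℝ
          - δ * (⟪-u + v + (ki / kp ^ 2) • (l - w), w⟫_ℝ + ⟪l, (ki / kp ^ 2) • (l - w)⟫_ℝ))
          - σ * ⟪e, N⟫_ℝ := by
      have e1 : -(kp • u) + kp • v + ki • y = kp • (-u + v + (ki / kp ^ 2) • (l - w)) := by
        rw [hkiy]; module
      unfold lyapunovFormDeriv
      rw [e1, hkiy]
      simp only [inner_smul_right _ _ kp, inner_smul_left _ _ kp, conj_trivial, inner_neg_right]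
      ring
    rw [hrw, hσ]
    refine hgain.trans ?_
    have h1 : d / B * lyapunovForm a b δ σ l w e ≤
        d / B * (B * (‖l‖ ^ 2 + ‖w‖ ^ 2 + ‖e‖ ^ 2)) := by gcongr
    have h2 : d / B * (B * (‖l‖ ^ 2 + ‖w‖ ^ 2 + ‖e‖ ^ 2)) =
        d * (‖l‖ ^ 2 + ‖w‖ ^ 2) + d * ‖e‖ ^ 2 := by field_simp
    have h3 : d * (‖l‖ ^ 2 + ‖w‖ ^ 2) ≤ kp * c / 2 * (‖l‖ ^ 2 + ‖w‖ ^ 2) := by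
      gcongr; rw [hd]; exact min_le_left _ _
    have h4 : d * ‖e‖ ^ 2 ≤ 2 * kp * C * L ^ 2 * ‖e‖ ^ 2 := by
      gcongr; rw [hd]; exact min_le_right _ _
    rw [← hσ]
    linarith

end QuadraticForms

/-! ### Adjoint Jacobians and smoothness of gradients -/

section Jacobians

variable {a b : ℕ} {g : Euc a → Euc b}

theorem inner_jacT_left (x : Euc a) (v : Euc b) (u : Euc a) :
    ⟪jacT g x v, u⟫_ℝ = ⟪v, jac g x u⟫_ℝ :=
  ContinuousLinearMap.adjoint_inner_left _ _ _

theorem inner_jacT_right (x : Euc a) (u : Euc a) (v : Euc b) :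
    ⟪u, jacT g x v⟫_ℝ = ⟪jac g x u, v⟫_ℝ :=
  ContinuousLinearMap.adjoint_inner_right _ _ _

theorem contDiff_adjoint_apply {X : Type*} [NormedAddCommGroup X] [NormedSpace ℝ X]
    {A : X → Euc a →L[ℝ] Euc b} {v : X → Euc b} (hA : ContDiff ℝ ∞ A) (hv : ContDiff ℝ ∞ v) :
    ContDiff ℝ ∞ (fun x => ContinuousLinearMap.adjoint (A x) (v x)) := by
  have hlin : IsBoundedLinearMap ℝ
      (fun B : Euc a →L[ℝ] Euc b => ContinuousLinearMap.adjoint B) :=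
    { map_add := fun x y => map_add _ x y
      map_smul := fun c x => by simp
      bound := ⟨1, one_pos, fun x => by simp⟩ }
  exact (hlin.contDiff.comp hA).clm_apply hv

theorem contDiff_jacT_apply {X : Type*} [NormedAddCommGroup X] [NormedSpace ℝ X]
    (hg : ContDiff ℝ ∞ g) {p : X → Euc a} (hp : ContDiff ℝ ∞ p) {v : X → Euc b}
    (hv : ContDiff ℝ ∞ v) : ContDiff ℝ ∞ (fun x => jacT g (p x) (v x)) :=
  contDiff_adjoint_apply ((hg.fderiv_right (m := ∞) (by simp)).comp hp) hv

theorem contDiff_gradient {f : Euc a → ℝ} (hf : ContDiff ℝ ∞ f) :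
    ContDiff ℝ ∞ (gradient f) := by
  have hlin : IsBoundedLinearMap ℝ (fun l : StrongDual ℝ (Euc a) =>
      (InnerProductSpace.toDual ℝ (Euc a)).symm l) :=
    { map_add := fun x y => map_add _ x y
      map_smul := fun c x => by simp
      bound := ⟨1, one_pos, fun x => by simp⟩ }
  exact hlin.contDiff.comp (hf.fderiv_right (m := ∞) (by simp))

end Jacobians

/-! ### Geometry of the feasible set and the reduced objective -/

section NormalForm

variable {n m : ℕ} {f : Euc n → ℝ} {h : Euc n → Euc m} {q : Euc n → Euc (n - m)}
  {Ψ : EucPair m (n - m) → Euc n}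

namespace IsNormalFormDiffeo

theorem hasFDerivAt_q (H : IsNormalFormDiffeo h q Ψ) (x : Euc n) : HasFDerivAt q (jac q x) x :=
  (H.smooth_q.differentiable (by simp) x).hasFDerivAt

theorem norm_jacT_q (H : IsNormalFormDiffeo h q Ψ) (x : Euc n) (v : Euc (n - m)) :
    ‖jacT q x v‖ = ‖v‖ := by
  have h1 : ‖jacT q x v‖ ^ 2 = ‖v‖ ^ 2 := by
    rw [← real_inner_self_eq_norm_sq, inner_jacT_left, H.orthonormal, real_inner_self_eq_norm_sq]
  exact (sq_eq_sq₀ (norm_nonneg _) (norm_nonneg _)).1 h1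

theorem norm_jac_q_apply_le (H : IsNormalFormDiffeo h q Ψ) (x u : Euc n) :
    ‖jac q x u‖ ≤ ‖u‖ := by
  have h1 : ‖jac q x u‖ * ‖jac q x u‖ ≤ ‖u‖ * ‖jac q x u‖ := by
    calc ‖jac q x u‖ * ‖jac q x u‖ = ⟪u, jacT q x (jac q x u)⟫_ℝ := by
          rw [inner_jacT_right, real_inner_self_eq_norm_mul_norm]
      _ ≤ ‖u‖ * ‖jacT q x (jac q x u)‖ := real_inner_le_norm _ _
      _ = _ := by rw [H.norm_jacT_q]
  rcases (norm_nonneg (jac q x u)).eq_or_lt' with h0 | h0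
  · rw [h0]; exact norm_nonneg _
  · exact le_of_mul_le_mul_right h1 h0

theorem lipschitzWith_q (H : IsNormalFormDiffeo h q Ψ) : LipschitzWith 1 q :=
  lipschitzWith_of_nnnorm_fderiv_le (H.smooth_q.differentiable (by simp)) fun x => by
    rw [← NNReal.coe_le_coe, coe_nnnorm]
    exact ContinuousLinearMap.opNorm_le_bound _ zero_le_one
      (fun u => by simpa using! H.norm_jac_q_apply_le x u)

theorem jac_h_jacT_q (H : IsNormalFormDiffeo h q Ψ) (x : Euc n) (v : Euc (n - m)) :
    jac h x (jacT q x v) = 0 := by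
  refine ext_inner_left ℝ fun w => ?_
  rw [← inner_jacT_left, inner_jacT_right, H.orthogonal, inner_zero_left, inner_zero_right]

theorem h_inv (H : IsNormalFormDiffeo h q Ψ) (y : Euc m) (η : Euc (n - m)) :
    h (Ψ (WithLp.toLp 2 (y, η))) = y :=
  congrArg WithLp.fst (H.right_inv (WithLp.toLp 2 (y, η)))

theorem q_inv (H : IsNormalFormDiffeo h q Ψ) (y : Euc m) (η : Euc (n - m)) :
    q (Ψ (WithLp.toLp 2 (y, η))) = η :=
  congrArg WithLp.snd (H.right_inv (WithLp.toLp 2 (y, η)))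

theorem inv_eq (H : IsNormalFormDiffeo h q Ψ) (x : Euc n) :
    Ψ (WithLp.toLp 2 (h x, q x)) = x := H.left_inv x

theorem inv_zero_q (H : IsNormalFormDiffeo h q Ψ) {x : Euc n} (hx : h x = 0) :
    Ψ (WithLp.toLp 2 (0, q x)) = x := by
  rw [← hx, H.inv_eq]

theorem hasFDerivAt_normalMap (H : IsNormalFormDiffeo h q Ψ) (hh : ContDiff ℝ ∞ h) (x : Euc n) :
    HasFDerivAt (normalMap h q)
      ((WithLp.prodContinuousLinearEquiv 2 ℝ (Euc m) (Euc (n - m))).symm.toContinuousLinearMap ∘L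
        (jac h x).prod (jac q x)) x :=
  (WithLp.prodContinuousLinearEquiv 2 ℝ (Euc m) (Euc (n - m))).symm.hasFDerivAt.comp x
    ((hh.differentiable (by simp) x).hasFDerivAt.prodMk (H.hasFDerivAt_q x))

theorem fderiv_inv_jac (H : IsNormalFormDiffeo h q Ψ) (hh : ContDiff ℝ ∞ h) (x u : Euc n) :
    fderiv ℝ Ψ (normalMap h q x) (WithLp.toLp 2 (jac h x u, jac q x u)) = u := by
  have h1 := ((H.smooth_inv.differentiable (by simp) (normalMap h q x)).hasFDerivAt).comp x
    (H.hasFDerivAt_normalMap hh x)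
  have h2 : Ψ ∘ normalMap h q = id := funext H.left_inv
  rw [h2] at h1
  exact congrArg (fun A : Euc n →L[ℝ] Euc n => A u) (h1.unique (hasFDerivAt_id x))

/-- The Jacobian of `h` has a right inverse bounded by the Lipschitz constant of `Ψ`. -/
theorem exists_jac_h_right_inverse (H : IsNormalFormDiffeo h q Ψ) (hh : ContDiff ℝ ∞ h) {L : ℝ≥0}
    (hL : LipschitzWith L Ψ) (x : Euc n) (v : Euc m) : ∃ u, jac h x u = v ∧ ‖u‖ ≤ L * ‖v‖ := by
  have hι : LipschitzWith 1 (fun y : Euc m => (WithLp.toLp 2 (y, q x) : EucPair m (n - m))) :=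
    LipschitzWith.of_dist_le_mul fun y y' => by simp [WithLp.prod_dist_eq_of_L2]
  have hdι : Differentiable ℝ
      (fun y : Euc m => (WithLp.toLp 2 (y, q x) : EucPair m (n - m))) := fun y =>
    ((WithLp.prodContinuousLinearEquiv 2 ℝ (Euc m) (Euc (n - m))).symm.differentiableAt).comp y
      (differentiableAt_id.prodMk (differentiableAt_const _))
  -- The slice of `Ψ` at fixed `q x` is a Lipschitz section of `h`; its derivative is the right
  -- inverse sought.
  obtain ⟨g, hg⟩ : ∃ g : Euc m → Euc n, g = fun y => Ψ (WithLp.toLp 2 (y, q x)) := ⟨_, rfl⟩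
  have hgd : DifferentiableAt ℝ g (h x) := by
    rw [hg]
    exact (H.smooth_inv.differentiable (by simp) _).comp (h x) (hdι (h x))
  have hgL : LipschitzWith L g := by
    rw [hg]
    simpa using! hL.comp hι
  have hgx : g (h x) = x := by rw [hg]; exact H.inv_eq x
  have h1 : HasFDerivAt (h ∘ g) (jac h x ∘L fderiv ℝ g (h x)) (h x) := by
    refine HasFDerivAt.comp (h x) ?_ hgd.hasFDerivAt
    rw [hgx]
    exact (hh.differentiable (by simp) x).hasFDerivAt
  have h2 : h ∘ g = id := by rw [hg]; exact funext fun y => H.h_inv y _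
  rw [h2] at h1
  refine ⟨fderiv ℝ g (h x) v, DFunLike.congr_fun (h1.unique (hasFDerivAt_id _)) v, ?_⟩
  exact ContinuousLinearMap.le_of_opNorm_le _ (norm_fderiv_le_of_lipschitz ℝ hgL) v

theorem eq_zero_of_jac_eq_zero (H : IsNormalFormDiffeo h q Ψ) (hh : ContDiff ℝ ∞ h) {x u : Euc n}
    (h1 : jac h x u = 0) (h2 : jac q x u = 0) : u = 0 := by
  rw [← H.fderiv_inv_jac hh x u, h1, h2]
  exact map_zero _

/-- The feasible set is parametrized by `η ↦ Ψ(0, η)`, with derivative `∇q`. -/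
theorem hasFDerivAt_inv_zero (H : IsNormalFormDiffeo h q Ψ) (hh : ContDiff ℝ ∞ h)
    (η : Euc (n - m)) :
    HasFDerivAt (fun η : Euc (n - m) => Ψ (WithLp.toLp 2 (0, η)))
      (jacT q (Ψ (WithLp.toLp 2 (0, η)))) η := by
  have h1 : HasFDerivAt (fun η : Euc (n - m) => (WithLp.toLp 2 (0, η) : EucPair m (n - m)))
      ((WithLp.prodContinuousLinearEquiv 2 ℝ (Euc m) (Euc (n - m))).symm.toContinuousLinearMap ∘L
        (0 : Euc (n - m) →L[ℝ] Euc m).prod (ContinuousLinearMap.id ℝ _)) η :=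
    (WithLp.prodContinuousLinearEquiv 2 ℝ (Euc m) (Euc (n - m))).symm.hasFDerivAt.comp η
      ((hasFDerivAt_const _ _).prodMk (hasFDerivAt_id η))
  have h2 := ((H.smooth_inv.differentiable (by simp) (WithLp.toLp 2 (0, η))).hasFDerivAt).comp η h1
  refine h2.congr_fderiv (ContinuousLinearMap.ext fun v => ?_)
  -- The vector `∇q v` has `∇ᵀh`-image `0` and `∇ᵀq`-image `v`, so `DΨ` sends `(0, v)` to it.
  have h3 := H.fderiv_inv_jac hh (Ψ (WithLp.toLp 2 (0, η))) (jacT q (Ψ (WithLp.toLp 2 (0, η))) v)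
  rw [H.right_inv, H.jac_h_jacT_q, H.orthonormal] at h3
  exact h3

/-- The parametrization of the feasible set is an isometry: it and its left inverse `q` are both
nonexpansive. -/
theorem isometry_inv_zero (H : IsNormalFormDiffeo h q Ψ) (hh : ContDiff ℝ ∞ h) :
    Isometry (fun η : Euc (n - m) => Ψ (WithLp.toLp 2 (0, η))) := by
  have hlip : LipschitzWith 1 (fun η : Euc (n - m) => Ψ (WithLp.toLp 2 (0, η))) :=
    lipschitzWith_of_nnnorm_fderiv_le
      (fun η => (H.hasFDerivAt_inv_zero hh η).differentiableAt) fun η => by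
        rw [(H.hasFDerivAt_inv_zero hh η).fderiv, ← NNReal.coe_le_coe, coe_nnnorm]
        exact ContinuousLinearMap.opNorm_le_bound _ zero_le_one
          (fun v => by simp [H.norm_jacT_q])
  refine Isometry.of_dist_eq fun η η' => le_antisymm ?_ ?_
  · simpa using hlip.dist_le_mul η η'
  · simpa [H.q_inv] using H.lipschitzWith_q.dist_le_mul
      (Ψ (WithLp.toLp 2 (0, η))) (Ψ (WithLp.toLp 2 (0, η')))

/-- The feasible set is an affine subspace with direction the range of `∇q`. -/
theorem inv_zero_sub (H : IsNormalFormDiffeo h q Ψ) (hh : ContDiff ℝ ∞ h) (η η' : Euc (n - m)) :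
    Ψ (WithLp.toLp 2 (0, η')) - Ψ (WithLp.toLp 2 (0, η)) =
      jacT q (Ψ (WithLp.toLp 2 (0, η))) (η' - η) := by
  -- An isometry into a strictly convex space is affine even when it is not surjective; its linear
  -- part is then its derivative at any point.
  obtain ⟨A, hA⟩ : ∃ A : Euc (n - m) →ᵃⁱ[ℝ] Euc n,
      ⇑A = fun η : Euc (n - m) => Ψ (WithLp.toLp 2 (0, η)) :=
    ⟨(H.isometry_inv_zero hh).affineIsometryOfStrictConvexSpace, rfl⟩
  have h1 : ∀ η', A η' = A.linearIsometry (η' - η) + A η := fun η' => by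
    simpa using A.map_vadd η (η' - η)
  have h2 : HasFDerivAt A A.linearIsometry.toContinuousLinearMap η := by
    rw [show ⇑A = fun η' => A.linearIsometry (η' - η) + A η from funext h1]
    exact (A.linearIsometry.toContinuousLinearMap.hasFDerivAt.comp η
      ((hasFDerivAt_id η).sub_const η)).add_const _
  have h3 : A.linearIsometry.toContinuousLinearMap = jacT q (Ψ (WithLp.toLp 2 (0, η))) :=
    h2.unique (hA ▸ H.hasFDerivAt_inv_zero hh η)
  have h4 := h1 η'
  rw [← h3]
  simp only [hA] at h4
  rw [h4]
  simp

end IsNormalFormDiffeo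

/-- In the coordinate `η`, the objective is strongly convex on the feasible set. -/
theorem StronglyConvexOnFeasible.reduced {ρ : ℝ} (hc : StronglyConvexOnFeasible f h ρ)
    (H : IsNormalFormDiffeo h q Ψ) (hh : ContDiff ℝ ∞ h) (η η' : Euc (n - m)) :
    f (Ψ (WithLp.toLp 2 (0, η))) +
        ⟪jac q (Ψ (WithLp.toLp 2 (0, η))) (gradient f (Ψ (WithLp.toLp 2 (0, η)))), η' - η⟫_ℝ +
        ρ / 2 * ‖η' - η‖ ^ 2 ≤ f (Ψ (WithLp.toLp 2 (0, η'))) := by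
  have h1 := hc.ineq _ (H.h_inv 0 η) _ (H.h_inv 0 η')
  rwa [H.inv_zero_sub hh, inner_jacT_right, H.norm_jacT_q] at h1

/-- A minimizer over the feasible set exists, and there the tangential gradient vanishes. -/
theorem exists_critical_point {ρ : ℝ} (hf : ContDiff ℝ ∞ f) (hh : ContDiff ℝ ∞ h)
    (hc : StronglyConvexOnFeasible f h ρ) (H : IsNormalFormDiffeo h q Ψ) :
    ∃ xs, h xs = 0 ∧ jac q xs (gradient f xs) = 0 := by
  have hcont : Continuous (fun η : Euc (n - m) => f (Ψ (WithLp.toLp 2 (0, η)))) :=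
    hf.continuous.comp (H.isometry_inv_zero hh).continuous
  obtain ⟨G, hG⟩ : ∃ G, G = jac q (Ψ (WithLp.toLp 2 (0, 0))) (gradient f (Ψ (WithLp.toLp 2 (0, 0))))
    := ⟨_, rfl⟩
  -- Strong convexity based at `η = 0` gives a quadratic lower bound, hence coercivity.
  have hlow : ∀ η : Euc (n - m), f (Ψ (WithLp.toLp 2 (0, 0))) + (ρ / 2 * ‖η‖ - ‖G‖) * ‖η‖ ≤
      f (Ψ (WithLp.toLp 2 (0, η))) := by
    intro η
    have h1 := hc.reduced H hh 0 η
    rw [← hG, sub_zero] at h1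
    have h2 := neg_le_of_abs_le (abs_real_inner_le_norm G η)
    linarith
  have hρ := hc.rho_pos
  have htend : Filter.Tendsto (fun η : Euc (n - m) => f (Ψ (WithLp.toLp 2 (0, η))))
      (Filter.cocompact _) Filter.atTop := by
    refine Filter.tendsto_atTop_mono hlow (Filter.tendsto_atTop_add_const_left _ _ ?_)
    have hn : Filter.Tendsto (fun η : Euc (n - m) => ‖η‖) (Filter.cocompact _) Filter.atTop :=
      tendsto_norm_cocompact_atTop
    refine Filter.Tendsto.atTop_mul_atTop₀ ?_ hn
    exact Filter.tendsto_atTop_add_const_right _ _ (hn.const_mul_atTop (by positivity))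
  obtain ⟨η, hη⟩ := hcont.exists_forall_le htend
  refine ⟨Ψ (WithLp.toLp 2 (0, η)), H.h_inv 0 η, ?_⟩
  have hd := (hf.differentiable (by simp) (Ψ (WithLp.toLp 2 (0, η)))).hasFDerivAt.comp η
    (H.hasFDerivAt_inv_zero hh η)
  have hmin : IsLocalMin (f ∘ fun η : Euc (n - m) => Ψ (WithLp.toLp 2 (0, η))) η :=
    Filter.Eventually.of_forall hη
  have h0 := hmin.hasFDerivAt_eq_zero hd
  refine ext_inner_right ℝ fun v => ?_
  rw [inner_zero_left, ← inner_jacT_right, inner_gradient_left]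
  exact congrArg (fun A : Euc (n - m) →L[ℝ] ℝ => A v) h0

/-- A feasible critical point is the unique minimizer over the feasible set. -/
theorem StronglyConvexOnFeasible.lt_of_critical {ρ : ℝ} (hc : StronglyConvexOnFeasible f h ρ)
    (hh : ContDiff ℝ ∞ h) (H : IsNormalFormDiffeo h q Ψ) {xs x : Euc n} (hxs : h xs = 0)
    (hcrit : jac q xs (gradient f xs) = 0) (hx : h x = 0) (hne : x ≠ xs) : f xs < f x := by
  have h1 := hc.ineq xs hxs x hx
  have h2 : ⟪gradient f xs, x - xs⟫_ℝ = 0 := by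
    have h3 := H.inv_zero_sub hh (q xs) (q x)
    rw [H.inv_zero_q hx, H.inv_zero_q hxs] at h3
    rw [h3, inner_jacT_right, hcrit, inner_zero_left]
  have h4 : 0 < ‖x - xs‖ := norm_pos_iff.2 (sub_ne_zero.2 hne)
  have h5 := hc.rho_pos
  have : 0 < ρ / 2 * ‖x - xs‖ ^ 2 := by positivity
  linarith

/-- The tangential gradient points away from the solution, up to the constraint violation. -/
theorem StronglyConvexOnFeasible.inner_tangential_gradient_ge {ρ L₁ : ℝ}
    (hc : StronglyConvexOnFeasible f h ρ) (hh : ContDiff ℝ ∞ h) (H : IsNormalFormDiffeo h q Ψ)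
    (hL₁ : ∀ (y : Euc m) (η : Euc (n - m)),
      ‖jac q (Ψ (WithLp.toLp 2 (y, η))) (gradient f (Ψ (WithLp.toLp 2 (y, η))))
        - jac q (Ψ (WithLp.toLp 2 (0, η))) (gradient f (Ψ (WithLp.toLp 2 (0, η))))‖ ≤ L₁ * ‖y‖)
    {xs : Euc n} (hxs : h xs = 0) (hcrit : jac q xs (gradient f xs) = 0) (x : Euc n) :
    ρ * ‖q x - q xs‖ ^ 2 - L₁ * (‖q x - q xs‖ * ‖h x‖) ≤
      ⟪q x - q xs, jac q x (gradient f x)⟫_ℝ := by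
  -- Adding the two strong convexity inequalities gives strong monotonicity at the feasible point
  -- with the same `q`; `h3` transfers it to `x`.
  have h1 := hc.reduced H hh (q x) (q xs)
  have h2 := hc.reduced H hh (q xs) (q x)
  have h3 := hL₁ (h x) (q x)
  rw [H.inv_eq] at h3
  rw [H.inv_zero_q hxs] at h1 h2
  rw [hcrit, inner_zero_left] at h2
  rw [norm_sub_rev, ← neg_sub (q x), inner_neg_right, real_inner_comm] at h1
  have h4 := neg_le_of_abs_le ((abs_real_inner_le_norm (q x - q xs) _).trans
    (mul_le_mul_of_nonneg_left h3 (norm_nonneg _)))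
  rw [inner_sub_right] at h4
  linarith

end NormalForm

/-! ### Lyapunov's criterion and change of coordinates -/

section Lyapunov

/-- Lyapunov's criterion for global exponential stability in the coordinates `T`. -/
theorem IsGloballyExpStable.of_lyapunov {X : Type*} [NormedAddCommGroup X] [NormedSpace ℝ X]
    [FiniteDimensional ℝ X] {F T : X → X} {p : X} {W : X → ℝ} {W' : X → X →L[ℝ] ℝ}
    {r c₁ c₂ α β : ℝ} (hF : ContDiff ℝ ∞ F) (heq : ∃ e, T e = p ∧ F e = 0)
    (hW : ∀ s, HasFDerivAt W (W' s) s) (hr : 0 < r) (hdec : ∀ s, W' s (F s) ≤ -r * W s)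
    (hc₁ : 0 < c₁) (hc₂ : 0 < c₂) (hlow : ∀ s, c₁ * ‖T s - p‖ ^ 2 ≤ W s)
    (hup : ∀ s, W s ≤ c₂ * ‖T s - p‖ ^ 2) (hα : 0 ≤ α)
    (hbdd : ∀ s, ‖s‖ ≤ α * ‖T s - p‖ + β) : IsGloballyExpStable F T p where
  equilibrium := heq
  complete := by
    have hW0 : ∀ s, 0 ≤ W s := fun s => le_trans (by positivity) (hlow s)
    refine exists_forwardSolution_of_lyapunov hF hW
      (fun s => (hdec s).trans (by nlinarith [hW0 s])) (fun c => ?_)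
    -- A bound on `W` controls only the distance in the coordinates `T`; `hbdd` turns this into
    -- boundedness of the state.
    refine (Metric.isBounded_closedBall (x := (0 : X)) (r := α * √(c / c₁) + β)).subset ?_
    intro s hs
    rw [mem_closedBall_zero_iff]
    refine (hbdd s).trans ?_
    gcongr
    refine Real.le_sqrt_of_sq_le ?_
    rw [le_div_iff₀' hc₁]
    exact (hlow s).trans hs
  decay := by
    refine ⟨√(c₂ / c₁), r / 2, by positivity, by positivity, fun γ hγ t ht => ?_⟩
    have h1 : W (γ t) ≤ W (γ 0) * Real.exp (-r * t) :=
      le_mul_exp_of_hasDerivWithinAt (u := W ∘ γ)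
        (fun t ht => (hW (γ t)).comp_hasDerivWithinAt t (hγ t ht)) (fun t _ => hdec (γ t)) ht
    have h2 : W (γ 0) * Real.exp (-r * t) ≤ c₂ * ‖T (γ 0) - p‖ ^ 2 * Real.exp (-r * t) := by
      gcongr; exact hup _
    have h3 := (hlow (γ t)).trans (h1.trans h2)
    have h4 : Real.exp (-(r / 2) * t) ^ 2 = Real.exp (-r * t) := by
      rw [← Real.exp_nat_mul]; congr 1; push_cast; ring
    refine le_of_sq_le_sq ?_ (by positivity)
    rw [mul_pow, mul_pow, h4, Real.sq_sqrt (by positivity), div_mul_eq_mul_div,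
      div_mul_eq_mul_div, le_div_iff₀ hc₁]
    linarith

/-- Global exponential stability in one system of coordinates transfers to another one that has
comparable distances to the equilibrium. -/
theorem IsGloballyExpStable.change_coordinates {X : Type*} [NormedAddCommGroup X]
    [NormedSpace ℝ X] {F T T' : X → X} {p p' : X} {C C' : ℝ} (hs : IsGloballyExpStable F T p)
    (hC : 0 < C) (hC' : 0 < C') (heq : ∀ s, T s = p → T' s = p')
    (h1 : ∀ s, ‖T s - p‖ ≤ C * ‖T' s - p'‖) (h2 : ∀ s, ‖T' s - p'‖ ≤ C' * ‖T s - p‖) :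
    IsGloballyExpStable F T' p' where
  equilibrium := by
    obtain ⟨e, he, hFe⟩ := hs.equilibrium
    exact ⟨e, heq e he, hFe⟩
  complete := hs.complete
  decay := by
    obtain ⟨c, ρ, hc, hρ, hd⟩ := hs.decay
    refine ⟨C' * c * C, ρ, by positivity, hρ, fun γ hγ t ht => ?_⟩
    calc ‖T' (γ t) - p'‖ ≤ C' * ‖T (γ t) - p‖ := h2 _
      _ ≤ C' * (c * Real.exp (-ρ * t) * ‖T (γ 0) - p‖) := by
        gcongr; exact hd γ hγ t ht
      _ ≤ C' * (c * Real.exp (-ρ * t) * (C * ‖T' (γ 0) - p'‖)) := by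
        gcongr; exact h1 _
      _ = _ := by ring

variable {X E E' : Type*} [NormedAddCommGroup X] [NormedSpace ℝ X] [NormedAddCommGroup E]
  [InnerProductSpace ℝ E] [NormedAddCommGroup E'] [InnerProductSpace ℝ E']

theorem hasFDerivAt_lyapunovForm (a b δ σ : ℝ) {l w : X → E} {e : X → E'} {l' w' : X →L[ℝ] E}
    {e' : X →L[ℝ] E'} {s : X} (hl : HasFDerivAt l l' s) (hw : HasFDerivAt w w' s)
    (he : HasFDerivAt e e' s) :
    ∃ W' : X →L[ℝ] ℝ, HasFDerivAt (fun s => lyapunovForm a b δ σ (l s) (w s) (e s)) W' s ∧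
      ∀ v, W' v = lyapunovFormDeriv a b δ σ (l s) (w s) (e s) (l' v) (w' v) (e' v) := by
  have h1 := (((hl.norm_sq.const_mul (a / 2)).add (hw.norm_sq.const_mul (b / 2))).sub
    ((hl.inner ℝ hw).const_mul δ)).add (he.norm_sq.const_mul (σ / 2))
  refine ⟨_, h1, fun v => ?_⟩
  simp [lyapunovFormDeriv]
  ring

end Lyapunov

/-! ### Gram matrix, multiplier and inverse Lipschitz bounds -/

section Bounds

variable {n m : ℕ} {f : Euc n → ℝ} {h : Euc n → Euc m} {q : Euc n → Euc (n - m)}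
  {Ψ : EucPair m (n - m) → Euc n}

theorem lipschitzWith_of_normalMap {L : ℝ≥0} (hL : LipschitzWith L (normalMap h q)) :
    LipschitzWith L h :=
  LipschitzWith.of_dist_le_mul fun x x' => by
    refine le_trans ?_ (hL.dist_le_mul x x')
    rw [WithLp.prod_dist_eq_of_L2]
    exact Real.le_sqrt_of_sq_le (le_add_of_nonneg_right (sq_nonneg _))

theorem norm_jac_apply_le {L : ℝ≥0} (hL : LipschitzWith L h) (x u : Euc n) :
    ‖jac h x u‖ ≤ L * ‖u‖ :=
  ContinuousLinearMap.le_of_opNorm_le _ (norm_fderiv_le_of_lipschitz ℝ hL) u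

theorem norm_jacT_apply_le {L : ℝ≥0} (hL : LipschitzWith L h) (x : Euc n) (v : Euc m) :
    ‖jacT h x v‖ ≤ L * ‖v‖ := by
  refine ContinuousLinearMap.le_of_opNorm_le _ ?_ v
  rw [jacT, LinearIsometryEquiv.norm_map]
  exact norm_fderiv_le_of_lipschitz ℝ hL

theorem inner_gram_self (x : Euc n) (v : Euc m) :
    ⟪v, jac h x (jacT h x v)⟫_ℝ = ‖jacT h x v‖ ^ 2 := by
  rw [← inner_jacT_left, real_inner_self_eq_norm_sq]

/-- Pairing `∇h v` with a preimage `u` of `v` under `∇ᵀh`, `‖u‖ ≤ L ‖v‖`, gives `‖v‖ ≤ L ‖∇h v‖`.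
The `+ 1` in the constant covers `L = 0`. -/
theorem IsNormalFormDiffeo.exists_gramLowerBound (H : IsNormalFormDiffeo h q Ψ)
    (hh : ContDiff ℝ ∞ h) {L : ℝ≥0} (hL : LipschitzWith L Ψ) :
    ∃ mlow : ℝ, 0 < mlow ∧ GramLowerBound h mlow := by
  refine ⟨1 / ((L : ℝ) ^ 2 + 1), by positivity, fun x v => ?_⟩
  rw [inner_gram_self, one_div, inv_mul_le_iff₀ (by positivity)]
  obtain ⟨u, hu, huv⟩ := H.exists_jac_h_right_inverse hh hL x v
  have h1 : ‖v‖ * ‖v‖ ≤ (L * ‖jacT h x v‖) * ‖v‖ := by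
    calc ‖v‖ * ‖v‖ = ⟪jacT h x v, u⟫_ℝ := by
          rw [inner_jacT_left, hu, real_inner_self_eq_norm_mul_norm]
      _ ≤ ‖jacT h x v‖ * ‖u‖ := real_inner_le_norm _ _
      _ ≤ ‖jacT h x v‖ * (L * ‖v‖) := by gcongr
      _ = _ := by ring
  have h2 : ‖v‖ ≤ L * ‖jacT h x v‖ := by
    rcases (norm_nonneg v).eq_or_lt' with h0 | h0
    · rw [h0]; positivity
    · exact le_of_mul_le_mul_right h1 h0
  calc ‖v‖ ^ 2 ≤ (L * ‖jacT h x v‖) ^ 2 := by gcongr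
    _ ≤ _ := by nlinarith [sq_nonneg ‖jacT h x v‖]

theorem GramLowerBound.isInvertible {mlow : ℝ} (hG : GramLowerBound h mlow) (hm : 0 < mlow)
    (x : Euc n) : (jac h x ∘L jacT h x).IsInvertible := by
  have hinj : Function.Injective (jac h x ∘L jacT h x).toLinearMap := by
    rw [← LinearMap.ker_eq_bot, LinearMap.ker_eq_bot']
    intro v hv
    have h1 := hG x v
    have h2 : jac h x (jacT h x v) = 0 := hv
    rw [h2, inner_zero_right] at h1
    have h3 : ‖v‖ ^ 2 ≤ 0 := nonpos_of_mul_nonpos_right h1 hm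
    exact norm_eq_zero.1 (pow_eq_zero_iff two_ne_zero |>.1 (le_antisymm h3 (sq_nonneg _)))
  refine ⟨(LinearEquiv.ofInjectiveEndo _ hinj).toContinuousLinearEquiv, ?_⟩
  ext1 v
  rfl

/-- This normal equation turns the derivative of `h` along the flow into `G (φ(x) - λ)`. -/
theorem GramLowerBound.gram_multiplierMap {mlow : ℝ} (hG : GramLowerBound h mlow)
    (hm : 0 < mlow) (x : Euc n) :
    jac h x (jacT h x (multiplierMap f h x)) = -jac h x (gradient f x) := by
  rw [multiplierMap, map_neg, map_neg]
  exact congrArg Neg.neg ((hG.isInvertible hm x).self_apply_inverse _)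

/-- Applying `∇ᵀh` determines the multiplier. Conversely the residual is killed by both `∇ᵀh` and
`∇ᵀq`, which are jointly injective. -/
theorem IsNormalFormDiffeo.multiplier_iff (H : IsNormalFormDiffeo h q Ψ) (hh : ContDiff ℝ ∞ h)
    {mlow : ℝ} (hG : GramLowerBound h mlow) (hm : 0 < mlow) {xs : Euc n}
    (hcrit : jac q xs (gradient f xs) = 0) (lam : Euc m) :
    gradient f xs + jacT h xs lam = 0 ↔ lam = multiplierMap f h xs := by
  constructor
  · intro h0
    have h1 : jac h xs (gradient f xs + jacT h xs lam) = 0 := by rw [h0, map_zero]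
    rw [map_add] at h1
    refine (hG.isInvertible hm xs).injective ?_
    refine Eq.trans ?_ (hG.gram_multiplierMap hm xs).symm
    exact (neg_eq_of_add_eq_zero_right h1).symm
  · rintro rfl
    refine H.eq_zero_of_jac_eq_zero hh (x := xs) ?_ ?_
    · rw [map_add, hG.gram_multiplierMap hm, add_neg_cancel]
    · rw [map_add, hcrit, H.orthogonal, add_zero]

theorem norm_sub_le_of_inverse (H : IsNormalFormDiffeo h q Ψ) {L : ℝ≥0} (hL : LipschitzWith L Ψ)
    {xs : Euc n} (hxs : h xs = 0) (x : Euc n) :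
    ‖x - xs‖ ≤ L * (‖h x‖ + ‖q x - q xs‖) := by
  have h1 := hL.dist_le_mul (normalMap h q x) (normalMap h q xs)
  rw [H.left_inv, H.left_inv, dist_eq_norm] at h1
  refine h1.trans ?_
  gcongr
  rw [WithLp.prod_dist_eq_of_L2]
  have e1 : dist (normalMap h q x).fst (normalMap h q xs).fst = ‖h x‖ := by
    rw [dist_eq_norm]
    change ‖h x - h xs‖ = _
    rw [hxs, sub_zero]
  have e2 : dist (normalMap h q x).snd (normalMap h q xs).snd = ‖q x - q xs‖ := dist_eq_norm _ _
  rw [e1, e2]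
  refine Real.sqrt_le_iff.2 ⟨by positivity, ?_⟩
  nlinarith [mul_nonneg (norm_nonneg (h x)) (norm_nonneg (q x - q xs))]

end Bounds

/-! ### The PI dynamics and the augmented Lagrangian flow -/

section Flows

variable {n m : ℕ} {f : Euc n → ℝ} {h : Euc n → Euc m} {q : Euc n → Euc (n - m)}
  {Ψ : EucPair m (n - m) → Euc n}

theorem contDiff_piField (hf : ContDiff ℝ ∞ f) (hh : ContDiff ℝ ∞ h) (kp ki : ℝ) :
    ContDiff ℝ ∞ (piField f h kp ki) := by
  have hfst : ContDiff ℝ ∞ (fun s : EucPair n m => s.fst) := (WithLp.fstL 2 ℝ (Euc n) (Euc m)).contDiff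
  have hsnd : ContDiff ℝ ∞ (fun s : EucPair n m => s.snd) := (WithLp.sndL 2 ℝ (Euc n) (Euc m)).contDiff
  have hhf : ContDiff ℝ ∞ (fun s : EucPair n m => h s.fst) := hh.comp hfst
  exact (WithLp.prodContinuousLinearEquiv 2 ℝ (Euc n) (Euc m)).symm.contDiff.comp
    ((((contDiff_gradient hf).comp hfst).neg.sub (contDiff_jacT_apply hh hfst
      ((hhf.const_smul kp).add (hsnd.const_smul ki)))).prodMk hhf)

/-- The Lyapunov function of the PI dynamics. -/
noncomputable def piLyapunov (h : Euc n → Euc m) (q : Euc n → Euc (n - m)) (kp ki a b δ σ : ℝ) (xs : Euc n)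
    (lams : Euc m) (s : EucPair n m) : ℝ :=
  lyapunovForm a b δ σ (kp • h s.fst + ki • s.snd - lams) (ki • s.snd - lams) (q s.fst - q xs)

theorem hasFDerivAt_piLyapunov (hh : ContDiff ℝ ∞ h) (hq : ContDiff ℝ ∞ q)
    (kp ki a b δ σ : ℝ) (xs : Euc n) (lams : Euc m) (s : EucPair n m) :
    ∃ W' : EucPair n m →L[ℝ] ℝ,
      HasFDerivAt (piLyapunov h q kp ki a b δ σ xs lams) W' s ∧
      ∀ v, W' v = lyapunovFormDeriv a b δ σ (kp • h s.fst + ki • s.snd - lams)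
        (ki • s.snd - lams) (q s.fst - q xs) (kp • jac h s.fst v.fst + ki • v.snd) (ki • v.snd)
        (jac q s.fst v.fst) := by
  have hfst : HasFDerivAt (fun s : EucPair n m => s.fst) (WithLp.fstL 2 ℝ (Euc n) (Euc m)) s :=
    (WithLp.fstL 2 ℝ (Euc n) (Euc m)).hasFDerivAt
  have hsnd : HasFDerivAt (fun s : EucPair n m => s.snd) (WithLp.sndL 2 ℝ (Euc n) (Euc m)) s :=
    (WithLp.sndL 2 ℝ (Euc n) (Euc m)).hasFDerivAt
  have hhd : HasFDerivAt (fun s : EucPair n m => h s.fst)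
      (jac h s.fst ∘L WithLp.fstL 2 ℝ (Euc n) (Euc m)) s :=
    HasFDerivAt.comp s (hh.differentiable (by simp) s.fst).hasFDerivAt hfst
  have hqd : HasFDerivAt (fun s : EucPair n m => q s.fst)
      (jac q s.fst ∘L WithLp.fstL 2 ℝ (Euc n) (Euc m)) s :=
    HasFDerivAt.comp s (hq.differentiable (by simp) s.fst).hasFDerivAt hfst
  obtain ⟨W', h1, h2⟩ := hasFDerivAt_lyapunovForm a b δ σ
    (((hhd.const_smul kp).add (hsnd.const_smul ki)).sub_const lams)
    ((hsnd.const_smul ki).sub_const lams) (hqd.sub_const (q xs))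
  exact ⟨W', h1, fun v => h2 v⟩

theorem norm_sq_piCoord_sub (kp ki : ℝ) (xs : Euc n) (lams : Euc m) (s : EucPair n m) :
    ‖piCoord h kp ki s - WithLp.toLp 2 (xs, lams)‖ ^ 2 =
      ‖s.fst - xs‖ ^ 2 + ‖kp • h s.fst + ki • s.snd - lams‖ ^ 2 :=
  WithLp.prod_norm_sq_eq_of_L2 _

/-- The error coordinates of the Lyapunov function are bounded by the distance to equilibrium. -/
theorem error_sq_le (H : IsNormalFormDiffeo h q Ψ) {L : ℝ≥0} (hL : LipschitzWith L h)
    {xs : Euc n} (hxs : h xs = 0) (kp ki : ℝ) (lams : Euc m) (s : EucPair n m) :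
    ‖kp • h s.fst + ki • s.snd - lams‖ ^ 2 + ‖ki • s.snd - lams‖ ^ 2 + ‖q s.fst - q xs‖ ^ 2 ≤
      (3 + 2 * kp ^ 2 * (L : ℝ) ^ 2) *
        ‖piCoord h kp ki s - WithLp.toLp 2 (xs, lams)‖ ^ 2 := by
  rw [norm_sq_piCoord_sub]
  have hq : ‖q s.fst - q xs‖ ≤ ‖s.fst - xs‖ := by
    simpa [dist_eq_norm] using H.lipschitzWith_q.dist_le_mul s.fst xs
  have hh : ‖h s.fst‖ ≤ L * ‖s.fst - xs‖ := by
    simpa [dist_eq_norm, hxs] using hL.dist_le_mul s.fst xs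
  have hw : ‖ki • s.snd - lams‖ ≤
      ‖kp • h s.fst + ki • s.snd - lams‖ + |kp| * (L * ‖s.fst - xs‖) := by
    have e1 : ki • s.snd - lams = (kp • h s.fst + ki • s.snd - lams) - kp • h s.fst := by abel
    rw [e1]
    refine (norm_sub_le _ _).trans ?_
    rw [norm_smul, Real.norm_eq_abs]
    gcongr
  have hw2 : ‖ki • s.snd - lams‖ ^ 2 ≤ 2 * ‖kp • h s.fst + ki • s.snd - lams‖ ^ 2 +
      2 * (kp ^ 2 * ((L : ℝ) ^ 2 * ‖s.fst - xs‖ ^ 2)) := by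
    refine (pow_le_pow_left₀ (norm_nonneg _) hw 2).trans ?_
    refine (add_sq_le).trans (le_of_eq ?_)
    rw [mul_pow, mul_pow, sq_abs]
    ring
  have hq2 : ‖q s.fst - q xs‖ ^ 2 ≤ ‖s.fst - xs‖ ^ 2 := by gcongr
  have h1 : 0 ≤ kp ^ 2 * (L : ℝ) ^ 2 * ‖kp • h s.fst + ki • s.snd - lams‖ ^ 2 := by positivity
  have h2 := sq_nonneg ‖s.fst - xs‖
  linarith

/-- The distance to equilibrium is bounded by the error coordinates of the Lyapunov function. -/
theorem le_error_sq (H : IsNormalFormDiffeo h q Ψ) {L : ℝ≥0} (hL : LipschitzWith L Ψ)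
    {xs : Euc n} (hxs : h xs = 0) {kp : ℝ} (hkp : 0 < kp) (ki : ℝ) (lams : Euc m)
    (s : EucPair n m) :
    ‖piCoord h kp ki s - WithLp.toLp 2 (xs, lams)‖ ^ 2 ≤
      (1 + 4 * (L : ℝ) ^ 2 / kp ^ 2 + 2 * (L : ℝ) ^ 2) *
        (‖kp • h s.fst + ki • s.snd - lams‖ ^ 2 + ‖ki • s.snd - lams‖ ^ 2 +
          ‖q s.fst - q xs‖ ^ 2) := by
  rw [norm_sq_piCoord_sub]
  obtain ⟨l, hl⟩ : ∃ l, l = kp • h s.fst + ki • s.snd - lams := ⟨_, rfl⟩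
  obtain ⟨w, hw⟩ : ∃ w, w = ki • s.snd - lams := ⟨_, rfl⟩
  rw [← hl, ← hw]
  have hy : kp * ‖h s.fst‖ = ‖l - w‖ := by
    rw [← Real.norm_of_nonneg hkp.le, ← norm_smul, hl, hw]
    congr 1
    abel
  have hy2 : ‖h s.fst‖ ^ 2 ≤ 2 * (‖l‖ ^ 2 + ‖w‖ ^ 2) / kp ^ 2 := by
    rw [le_div_iff₀ (by positivity), mul_comm, ← mul_pow, hy]
    exact (pow_le_pow_left₀ (norm_nonneg _) (norm_sub_le l w) 2).trans add_sq_le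
  have hx := norm_sub_le_of_inverse H hL hxs s.fst
  have hx2 : ‖s.fst - xs‖ ^ 2 ≤
      (L : ℝ) ^ 2 * (2 * (2 * (‖l‖ ^ 2 + ‖w‖ ^ 2) / kp ^ 2 + ‖q s.fst - q xs‖ ^ 2)) := by
    refine (pow_le_pow_left₀ (norm_nonneg _) hx 2).trans ?_
    rw [mul_pow]
    gcongr
    refine add_sq_le.trans ?_
    gcongr
  have e1 : (L : ℝ) ^ 2 * (2 * (2 * (‖l‖ ^ 2 + ‖w‖ ^ 2) / kp ^ 2 + ‖q s.fst - q xs‖ ^ 2)) =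
      4 * (L : ℝ) ^ 2 / kp ^ 2 * (‖l‖ ^ 2 + ‖w‖ ^ 2) + 2 * (L : ℝ) ^ 2 * ‖q s.fst - q xs‖ ^ 2 := by
    ring
  have h1 : 0 ≤ 4 * (L : ℝ) ^ 2 / kp ^ 2 * ‖q s.fst - q xs‖ ^ 2 := by positivity
  have h2 : 0 ≤ 2 * (L : ℝ) ^ 2 * (‖l‖ ^ 2 + ‖w‖ ^ 2) := by positivity
  have h3 := sq_nonneg ‖q s.fst - q xs‖
  have h4 := sq_nonneg ‖w‖
  linarith

/-- Since `ki > 0`, the integrator state is recovered from `λ` and `h(x)`; this supplies the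
boundedness hypothesis of Lyapunov's criterion. -/
theorem norm_le_piCoord {L : ℝ≥0} (hL : LipschitzWith L h) {xs : Euc n} (hxs : h xs = 0)
    {kp ki : ℝ} (hkp : 0 < kp) (hki : 0 < ki) (lams : Euc m) (s : EucPair n m) :
    ‖s‖ ≤ (1 + (1 + kp * L) / ki) * ‖piCoord h kp ki s - WithLp.toLp 2 (xs, lams)‖ +
      (‖xs‖ + ‖lams‖ / ki) := by
  obtain ⟨D, hD⟩ : ∃ D, D = ‖piCoord h kp ki s - WithLp.toLp 2 (xs, lams)‖ := ⟨_, rfl⟩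
  have hsq := norm_sq_piCoord_sub (h := h) kp ki xs lams s
  rw [← hD] at hsq ⊢
  have hD0 : 0 ≤ D := by rw [hD]; positivity
  have hx : ‖s.fst - xs‖ ≤ D :=
    le_of_sq_le_sq (by rw [hsq]; exact le_add_of_nonneg_right (sq_nonneg _)) hD0
  have hl : ‖kp • h s.fst + ki • s.snd - lams‖ ≤ D :=
    le_of_sq_le_sq (by rw [hsq]; exact le_add_of_nonneg_left (sq_nonneg _)) hD0
  have hh : ‖h s.fst‖ ≤ L * D := by
    have h1 : ‖h s.fst‖ ≤ L * ‖s.fst - xs‖ := by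
      simpa [dist_eq_norm, hxs] using hL.dist_le_mul s.fst xs
    exact h1.trans (by gcongr)
  have hz : ki * ‖s.snd‖ ≤ D + ‖lams‖ + kp * (L * D) := by
    have e1 : ki • s.snd = (kp • h s.fst + ki • s.snd - lams) + lams - kp • h s.fst := by abel
    calc ki * ‖s.snd‖ = ‖ki • s.snd‖ := by rw [norm_smul, Real.norm_of_nonneg hki.le]
      _ = ‖(kp • h s.fst + ki • s.snd - lams) + lams - kp • h s.fst‖ := congrArg norm e1
      _ ≤ ‖kp • h s.fst + ki • s.snd - lams‖ + ‖lams‖ + ‖kp • h s.fst‖ :=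
        (norm_sub_le _ _).trans (add_le_add_left (norm_add_le _ _) _)
      _ ≤ _ := by
        rw [norm_smul, Real.norm_of_nonneg hkp.le]
        gcongr
  have hz' : ‖s.snd‖ ≤ (D + ‖lams‖ + kp * (L * D)) / ki := by rwa [le_div_iff₀' hki]
  have hx' : ‖s.fst‖ ≤ D + ‖xs‖ := by
    calc ‖s.fst‖ = ‖(s.fst - xs) + xs‖ := by rw [sub_add_cancel]
      _ ≤ _ := (norm_add_le _ _).trans (by gcongr)
  have hs : ‖s‖ ≤ ‖s.fst‖ + ‖s.snd‖ := by
    refine le_of_sq_le_sq ?_ (by positivity)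
    rw [WithLp.prod_norm_sq_eq_of_L2]
    nlinarith [mul_nonneg (norm_nonneg s.fst) (norm_nonneg s.snd)]
  have e2 : (D + ‖lams‖ + kp * (L * D)) / ki = (1 + kp * L) / ki * D + ‖lams‖ / ki := by ring
  linarith

/-- Global exponential stability of the PI dynamics, with a threshold for `kp` that does not depend
on `ki`. -/
theorem exists_piField_stable (hf : ContDiff ℝ ∞ f) (hh : ContDiff ℝ ∞ h) {ρ : ℝ}
    (hc : StronglyConvexOnFeasible f h ρ) (H : IsNormalFormDiffeo h q Ψ) (hlip : BiLipschitz h q Ψ)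
    (htrans : TransverseLipschitz f q Ψ) {L₂ : ℝ≥0} (hmult : LipschitzWith L₂ (multiplierMap f h))
    {xs : Euc n} (hxs : h xs = 0) (hcrit : jac q xs (gradient f xs) = 0) {mlow : ℝ}
    (hm : 0 < mlow) (hG : GramLowerBound h mlow) :
    ∃ kpStar : ℝ, 0 < kpStar ∧ ∀ kp ki : ℝ, kpStar < kp → 0 < ki → ki < mlow * kp ^ 2 →
      IsGloballyExpStable (piField f h kp ki) (piCoord h kp ki)
        (WithLp.toLp 2 (xs, multiplierMap f h xs)) := by
  obtain ⟨⟨LΦ, hLΦ⟩, LΨ, hLΨ⟩ := hlip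
  obtain ⟨L₁, -, hL₁⟩ := htrans
  have hLh := lipschitzWith_of_normalMap hLΦ
  -- `LΦ ^ 2` bounds the Gram matrix and the maximum secures `m ≤ M`; `L₂ * LΨ` bounds the
  -- multiplier disturbance and the `+ 1` makes the constant positive.
  obtain ⟨kpStar, hpos, hkp⟩ := exists_lyapunovForm (E := Euc m) (E' := Euc (n - m)) (L₁ := L₁)
    hm (le_max_left mlow ((LΦ : ℝ) ^ 2)) (show (0 : ℝ) < L₂ * LΨ + 1 by positivity) hc.rho_pos
  refine ⟨kpStar, hpos, fun kp ki hkpl hki hkim => ?_⟩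
  have hkp0 : 0 < kp := hpos.trans hkpl
  obtain ⟨a, b, δ, σ, c₀, r, hc₀, hr, hlow, hdec⟩ := hkp kp ki hkpl hki hkim
  obtain ⟨lams, hlams⟩ : ∃ lams, lams = multiplierMap f h xs := ⟨_, rfl⟩
  rw [← hlams]
  choose W' hW hW' using hasFDerivAt_piLyapunov hh H.smooth_q kp ki a b δ σ xs lams
  have hgram : ∀ x v, ‖jac h x (jacT h x v)‖ ≤ max mlow ((LΦ : ℝ) ^ 2) * ‖v‖ := fun x v =>
    calc ‖jac h x (jacT h x v)‖ ≤ LΦ * ‖jacT h x v‖ := norm_jac_apply_le hLh _ _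
      _ ≤ LΦ * (LΦ * ‖v‖) := by gcongr; exact norm_jacT_apply_le hLh _ _
      _ = (LΦ : ℝ) ^ 2 * ‖v‖ := by ring
      _ ≤ _ := by gcongr; exact le_max_right _ _
  refine IsGloballyExpStable.of_lyapunov (W := piLyapunov h q kp ki a b δ σ xs lams) (W' := W')
    (r := r) (c₁ := c₀ / (1 + 4 * (LΨ : ℝ) ^ 2 / kp ^ 2 + 2 * (LΨ : ℝ) ^ 2))
    (c₂ := (|a| + |b| + |δ| + |σ| + 1) * (3 + 2 * kp ^ 2 * (LΦ : ℝ) ^ 2))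
    (contDiff_piField hf hh kp ki) ?_ hW hr ?_ (by positivity) (by positivity) ?_ ?_
    (show 0 ≤ 1 + (1 + kp * LΦ) / ki by positivity) (norm_le_piCoord hLh hxs hkp0 hki lams)
  · refine ⟨WithLp.toLp 2 (xs, ki⁻¹ • lams), ?_, ?_⟩
    · simp [piCoord, hxs, smul_smul, hki.ne']
    · have h1 := (H.multiplier_iff hh hG hm hcrit lams).2 hlams
      have h2 : -gradient f xs - jacT h xs lams = 0 := by
        rw [← neg_add', h1, neg_zero]
      simp [piField, hxs, smul_smul, hki.ne', h2]
  · intro s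
    rw [hW']
    -- The normal equation replaces `∇ᵀh ∇f` by `-G φ`, and `G λ⋆` is added and subtracted.
    have hl' : kp • jac h s.fst (piField f h kp ki s).fst + ki • (piField f h kp ki s).snd =
        -(kp • jac h s.fst (jacT h s.fst (kp • h s.fst + ki • s.snd - lams))) +
          kp • jac h s.fst (jacT h s.fst (multiplierMap f h s.fst - lams)) + ki • h s.fst := by
      change kp • jac h s.fst (-gradient f s.fst - jacT h s.fst (kp • h s.fst + ki • s.snd)) +
        ki • h s.fst = _
      simp only [map_sub, map_neg, hG.gram_multiplierMap hm]
      module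
    have he' : jac q s.fst (piField f h kp ki s).fst = -jac q s.fst (gradient f s.fst) := by
      change jac q s.fst (-gradient f s.fst - jacT h s.fst (kp • h s.fst + ki • s.snd)) = _
      rw [map_sub, H.orthogonal, sub_zero, map_neg]
    rw [hl', he']
    refine hdec _ _ (h s.fst) _ _ _ _ ‖multiplierMap f h s.fst - lams‖ (by abel) (hG _ _)
      (hgram _ _) (norm_nonneg _) (hgram _ _) ?_
      (hc.inner_tangential_gradient_ge hh H hL₁ hxs hcrit s.fst)
    have h1 := hmult.dist_le_mul s.fst xs
    rw [dist_eq_norm, dist_eq_norm, ← hlams] at h1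
    calc _ ≤ L₂ * (LΨ * (‖h s.fst‖ + ‖q s.fst - q xs‖)) :=
          h1.trans (by gcongr; exact norm_sub_le_of_inverse H hLΨ hxs s.fst)
      _ = L₂ * LΨ * (‖h s.fst‖ + ‖q s.fst - q xs‖) := by ring
      _ ≤ _ := by gcongr; exact le_add_of_nonneg_right zero_le_one
  · intro s
    rw [div_mul_eq_mul_div, div_le_iff₀ (by positivity)]
    have hpc := hlow (kp • h s.fst + ki • s.snd - lams) (ki • s.snd - lams) (q s.fst - q xs)
    refine (mul_le_mul_of_nonneg_left (le_error_sq H hLΨ hxs hkp0 ki lams s) hc₀.le).trans ?_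
    rw [mul_left_comm, mul_comm]
    exact mul_le_mul_of_nonneg_right hpc (by positivity)
  · intro s
    refine (lyapunovForm_le a b δ σ _ _ _).trans ?_
    rw [mul_assoc]
    exact mul_le_mul (le_add_of_nonneg_right zero_le_one)
      (error_sq_le H hLh hxs kp ki lams s) (by positivity) (by positivity)

theorem hasGradientAt_augLagrangian (hf : ContDiff ℝ ∞ f) (hh : ContDiff ℝ ∞ h) (w : ℝ)
    (x : Euc n) (lam : Euc m) :
    HasGradientAt (fun x => augLagrangian f h w x lam)
      (gradient f x + jacT h x (w • h x + lam)) x := by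
  have hfd := (hf.differentiable (by simp) x).hasFDerivAt
  have hhd : HasFDerivAt h (jac h x) x := (hh.differentiable (by simp) x).hasFDerivAt
  rw [hasGradientAt_iff_hasFDerivAt]
  refine ((hfd.add ((hasFDerivAt_const lam x).inner ℝ hhd)).add
    (hhd.norm_sq.const_mul (w / 2))).congr_fderiv (ContinuousLinearMap.ext fun v => ?_)
  simp [inner_jacT_left]
  ring

theorem hasGradientAt_augLagrangian_multiplier (w : ℝ) (x : Euc n) (lam : Euc m) :
    HasGradientAt (fun lam => augLagrangian f h w x lam) (h x) lam := by
  rw [hasGradientAt_iff_hasFDerivAt]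
  refine ((((hasFDerivAt_id lam).inner ℝ (hasFDerivAt_const (h x) lam)).const_add
    (f x)).add_const (w / 2 * ‖h x‖ ^ 2)).congr_fderiv (ContinuousLinearMap.ext fun v => ?_)
  simp [real_inner_comm]

/-- The primal-dual flow of the augmented Lagrangian is the PI dynamics with unit integral gain. -/
theorem almField_eq_piField (hf : ContDiff ℝ ∞ f) (hh : ContDiff ℝ ∞ h) (w : ℝ) :
    almField f h w = piField f h w 1 := by
  funext s
  rw [almField, piField, (hasGradientAt_augLagrangian hf hh w s.fst s.snd).gradient,
    (hasGradientAt_augLagrangian_multiplier w s.fst s.snd).gradient, one_smul, neg_add']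

/-- For unit integral gain, the coordinates `(x, λ)` of the PI dynamics and its state have
comparable distances to equilibrium. -/
theorem IsGloballyExpStable.of_piCoord_one {F : EucPair n m → EucPair n m} {L : ℝ≥0}
    (hL : LipschitzWith L h) {xs : Euc n} (hxs : h xs = 0) {lams : Euc m} {w : ℝ}
    (hs : IsGloballyExpStable F (piCoord h w 1) (WithLp.toLp 2 (xs, lams))) :
    IsGloballyExpStable F id (WithLp.toLp 2 (xs, lams)) := by
  have hh : ∀ x, ‖h x‖ ≤ L * ‖x - xs‖ := fun x => by
    simpa [dist_eq_norm, hxs] using hL.dist_le_mul x xs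
  -- The two coordinate vectors share `x` and differ by `w h(x)` in the multiplier, so one
  -- inequality serves both directions.
  have key : ∀ s t : EucPair n m, s.fst = t.fst →
      ‖s.snd - t.snd‖ ≤ |w| * ‖h s.fst‖ → ‖s - WithLp.toLp 2 (xs, lams)‖ ≤
        (1 + |w| * L) * ‖t - WithLp.toLp 2 (xs, lams)‖ := by
    intro s t hst hsnd
    have h1 : ‖t.fst - xs‖ ≤ ‖t - WithLp.toLp 2 (xs, lams)‖ := by
      refine le_of_sq_le_sq ?_ (norm_nonneg _)
      rw [WithLp.prod_norm_sq_eq_of_L2]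
      exact le_add_of_nonneg_right (sq_nonneg _)
    have h2 : ‖s - t‖ ≤ |w| * (L * ‖t - WithLp.toLp 2 (xs, lams)‖) := by
      have h3 : ‖s - t‖ = ‖s.snd - t.snd‖ := by
        refine (sq_eq_sq₀ (norm_nonneg _) (norm_nonneg _)).1 ?_
        rw [WithLp.prod_norm_sq_eq_of_L2]
        change ‖s.fst - t.fst‖ ^ 2 + ‖s.snd - t.snd‖ ^ 2 = _
        rw [hst, sub_self, norm_zero]
        ring
      rw [h3]
      refine hsnd.trans ?_
      gcongr
      rw [hst]
      exact (hh _).trans (by gcongr)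
    calc _ = ‖(s - t) + (t - WithLp.toLp 2 (xs, lams))‖ := by rw [sub_add_sub_cancel]
      _ ≤ _ := norm_add_le _ _
      _ ≤ _ := by linarith
  have hC : 0 < 1 + |w| * (L : ℝ) := by positivity
  have hsnd : ∀ s : EucPair n m, (piCoord h w 1 s).snd = w • h s.fst + s.snd := fun s => by
    change w • h s.fst + (1 : ℝ) • s.snd = _
    rw [one_smul]
  refine hs.change_coordinates hC hC (fun s hse => ?_) (fun s => ?_) (fun s => ?_)
  · have h1 : s.fst = xs := congrArg WithLp.fst hse
    have h2 := congrArg WithLp.snd hse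
    rw [hsnd, h1, hxs, smul_zero, zero_add] at h2
    change s.snd = lams at h2
    rw [← h1, ← h2]
    rfl
  · refine key _ s rfl ?_
    rw [hsnd, add_sub_cancel_right, norm_smul, Real.norm_eq_abs]
    exact le_rfl
  · refine key s _ rfl ?_
    rw [hsnd, sub_add_cancel_right, norm_neg, norm_smul, Real.norm_eq_abs]

end Flows

/-! ### Assembly of the theorem -/

theorem mainTheorem3 {n m : ℕ} (f : Euc n → ℝ) (h : Euc n → Euc m)
    (hf : ContDiff ℝ ∞ f) (hh : ContDiff ℝ ∞ h)
    (hrank : FullRowRank h)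
    (hconv : ∃ ρ : ℝ, StronglyConvexOnFeasible f h ρ)
    (q : Euc n → Euc (n - m)) (Ψ : EucPair m (n - m) → Euc n)
    (hdiffeo : IsNormalFormDiffeo h q Ψ)
    (hlip : BiLipschitz h q Ψ)
    (htrans : TransverseLipschitz f q Ψ)
    (hmult : ∃ L₂ : ℝ≥0, LipschitzWith L₂ (multiplierMap f h)) :
    ∃ (xs : Euc n) (lams : Euc m),
      -- the unique global solution of the constrained problem and its unique multiplier
      (h xs = 0 ∧ ∀ x, h x = 0 → x ≠ xs → f xs < f x) ∧
      (∀ lam : Euc m, gradient f xs + jacT h xs lam = 0 ↔ lam = lams) ∧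
      (∃ mlow : ℝ, 0 < mlow ∧ GramLowerBound h mlow) ∧
      ∀ mlow : ℝ, 0 < mlow → GramLowerBound h mlow →
        ∃ kpStar : ℝ,
          (∀ kp ki : ℝ, kpStar < kp → 0 < ki → ki < mlow * kp ^ 2 →
            IsGloballyExpStable (piField f h kp ki) (piCoord h kp ki)
              (WithLp.toLp 2 (xs, lams))) ∧
          (∀ w : ℝ, kpStar ≤ w →
            IsGloballyExpStable (almField f h w) id (WithLp.toLp 2 (xs, lams))) := by
  obtain ⟨ρ, hc⟩ := hconv
  obtain ⟨L₂, hL₂⟩ := hmult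
  obtain ⟨xs, hxs, hcrit⟩ := exists_critical_point hf hh hc hdiffeo
  have hLip := hlip
  obtain ⟨⟨LΦ, hLΦ⟩, LΨ, hLΨ⟩ := hLip
  obtain ⟨m₀, hm₀, hG₀⟩ := hdiffeo.exists_gramLowerBound hh hLΨ
  refine ⟨xs, multiplierMap f h xs,
    ⟨hxs, fun x hx hne => hc.lt_of_critical hh hdiffeo hxs hcrit hx hne⟩,
    hdiffeo.multiplier_iff hh hG₀ hm₀ hcrit, ⟨m₀, hm₀, hG₀⟩, fun mlow hm hG => ?_⟩
  obtain ⟨kpStar, hpos, hstable⟩ :=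
    exists_piField_stable hf hh hc hdiffeo hlip htrans hL₂ hxs hcrit hm hG
  have hmax : kpStar < kpStar + 1 + 1 / mlow := by
    have : 0 < 1 / mlow := by positivity
    linarith
  -- The enlarged threshold forces `w > 1` and `mlow * w > 1`, hence the gain condition `1 < mlow *
  -- w ^ 2` for `ki = 1`, and it makes the non-strict bound `w ≥ k_p⋆` sufficient.
  refine ⟨kpStar + 1 + 1 / mlow, fun kp ki hkp => hstable kp ki (hmax.trans hkp), fun w hw => ?_⟩
  have hw1 : 1 < w := by
    have : 0 < 1 / mlow := by positivity
    linarith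
  have hw2 : 1 < mlow * w ^ 2 := by
    have h1 : 1 / mlow < w := by linarith
    rw [div_lt_iff₀' hm] at h1
    nlinarith [mul_pos hm (zero_lt_one.trans hw1)]
  rw [almField_eq_piField hf hh]
  exact (hstable w 1 (hmax.trans_le hw) one_pos hw2).of_piCoord_one
    (lipschitzWith_of_normalMap hLΦ) hxs
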